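/- Let $\Sigma_{n\times r}(\mathbb{R}_{\ge 0})$ be the set of real $n\times r$ matrices with non-negative entries and with at least one positive entry in each row and in each column. Let $A=(a_{ij})\in\Sigma_{n\times r}(\mathbb{R}_{\ge 0})$. The Shintani series $$\zeta_A(s)=\sum_{m_1\ge 1}\cdots\sum_{m_r\ge 1}\ \prod_{i=1}^n (a_{i1}m_1+\dots+a_{ir}m_r)^{-s_i},\qquad s=(s_1,\dots,s_n)\in\mathbb{C}^n,$$ converges absolutely whenever $\operatorname{Re}(s_i)>r$ for all $1\le i\le n$, and there is a meromorphic function on $\mathbb{C}^n$ which equals $\zeta_A(s)$ at every $s$ where the series converges absolutely and whose poles are described as follows. For $J\subset[r]=\{1,\dots,r\}$ put $C_J(\epsilon)=\prod_{j\in J}\sum_{i=1}^n a_{ij}\epsilon_i$, let $\Delta_{C_J}\subset\mathbb{R}^n$ be its Newton polytope (the convex hull of the exponents of its monomials), and consider the polyhedron $\Delta_{C_J}+\mathbb{R}^n_{\ge 0}$. For each facet of this polyhedron, indexed by $k$, let $\mu_k^J\in\mathbb{Z}^n$ be its inward normal vector with mutually coprime coordinates and let $\nu_k^J\in\mathbb{Z}$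 be the integer such that the facet lies on $\{\sigma\in\mathbb{R}^n:\langle\mu_k^J,\sigma\rangle=\nu_k^J\}$; thus $\langle\mu_k^J,\sigma\rangle\ge\nu_k^J$ on the polyhedron. Let $\mathcal{H}$ be the set of all hyperplanes $$\{s\in\mathbb{C}^n:\ \langle\mu_k^J,s\rangle=\nu_k^J-l\},$$ where $J\subset[r]$, $k$ runs over the facets of $\Delta_{C_J}+\mathbb{R}^n_{\ge 0}$, and $l\in\mathbb{Z}_{\ge 0}$, with the restriction $0\le l\le\nu_k^J-1$ whenever $\mu_k^J$ is a vector $e_i$ of the canonical basis. Then all poles of the continuation lie on hyperplanes in $\mathcal{H}$ and are at most simple: each point $s_0\in\mathbb{C}^n$ has a neighbourhood on which the product of the continuation with finitely many of the affine forms $\langle\mu_k^J,s\rangle-(\nu_k^J-l)$ vanishing at $s_0$, one for each of finitely many distinct hyperplanes in $\mathcal{H}$ through $s_0$, is holomorphic (after removal of removable singularities). -/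

import Mathlib

open scoped Pointwise Topology

noncomputable section

/-- `Σ_{n×r}(ℝ_{≥0})`: real `n × r` matrices with non-negative entries, with at least one
positive entry in each row and in each column. -/
def ShintaniMatrices (n r : ℕ) : Set (Matrix (Fin n) (Fin r) ℝ) :=
  {A | (∀ i j, 0 ≤ A i j) ∧ (∀ i, ∃ j, 0 < A i j) ∧ (∀ j, ∃ i, 0 < A i j)}

/-- The term of index `m = (m₁, …, m_r)`, `m_j ≥ 1`, of the Shintani series of `A`:
`∏ i, (a_{i1} m₁ + ⋯ + a_{ir} m_r) ^ (-s_i)`. -/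
def shintaniTerm {n r : ℕ} (A : Matrix (Fin n) (Fin r) ℝ) (s : Fin n → ℂ) (m : Fin r → ℕ+) : ℂ :=
  ∏ i, ((∑ j, A i j * ((m j : ℕ) : ℝ) : ℝ) : ℂ) ^ (-s i)

/-- The Shintani zeta function of `A`, as the sum of its series; it is meaningful where the
series converges absolutely, that is where `Summable (shintaniTerm A s)`. -/
def shintaniZeta {n r : ℕ} (A : Matrix (Fin n) (Fin r) ℝ) (s : Fin n → ℂ) : ℂ :=
  ∑' m : Fin r → ℕ+, shintaniTerm A s m

/-- The polynomial `C_J(ε) = ∏_{j ∈ J} ∑_i a_{ij} ε_i`, the product of the linear forms given by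
the columns of `A` with index in `J`. -/
def columnProduct {n r : ℕ} (A : Matrix (Fin n) (Fin r) ℝ) (J : Finset (Fin r)) :
    MvPolynomial (Fin n) ℝ :=
  ∏ j ∈ J, ∑ i, MvPolynomial.C (A i j) * MvPolynomial.X i

/-- The Newton polytope `Δ_p`: the convex hull in `ℝⁿ` of the exponents of the monomials of `p`. -/
def newtonPolytope {n : ℕ} (p : MvPolynomial (Fin n) ℝ) : Set (Fin n → ℝ) :=
  convexHull ℝ ((fun (α : Fin n →₀ ℕ) (i : Fin n) => (α i : ℝ)) '' (p.support : Set (Fin n →₀ ℕ)))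

/-- The polyhedron `Δ_p + ℝⁿ_{≥0}` (Minkowski sum). -/
def newtonPolyhedron {n : ℕ} (p : MvPolynomial (Fin n) ℝ) : Set (Fin n → ℝ) :=
  newtonPolytope p + {x | ∀ i, 0 ≤ x i}

/-- The face of `P ⊆ ℝⁿ` cut out by the hyperplane `⟨μ, σ⟩ = ν`. -/
def faceOf {n : ℕ} (P : Set (Fin n → ℝ)) (μ : Fin n → ℤ) (ν : ℤ) : Set (Fin n → ℝ) :=
  {σ | σ ∈ P ∧ ∑ i, (μ i : ℝ) * σ i = ν}

/-- `μ ∈ ℤⁿ` is the primitive inward normal vector of a facet of the (full-dimensional) polyhedron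
`P ⊆ ℝⁿ`, and that facet lies on the hyperplane `⟨μ, σ⟩ = ν`: the coordinates of `μ` are mutually
coprime, `P` lies in the half-space `⟨μ, σ⟩ ≥ ν`, and the face of `P` on the boundary of this
half-space is non-empty and of dimension `n - 1`. -/
structure IsPrimitiveFacetNormal {n : ℕ} (P : Set (Fin n → ℝ)) (μ : Fin n → ℤ) (ν : ℤ) :
    Prop where
  primitive : Finset.univ.gcd μ = 1
  le_of_mem : ∀ σ ∈ P, (ν : ℝ) ≤ ∑ i, (μ i : ℝ) * σ i
  nonempty : (faceOf P μ ν).Nonempty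
  dim : Module.finrank ℝ (vectorSpan ℝ (faceOf P μ ν)) + 1 = n

/-- The affine form `s ↦ ⟨μ, s⟩ - c` on `ℂⁿ`, for `q = (μ, c)`; its zero set is the hyperplane
`⟨μ, s⟩ = c`. -/
def hyperplaneForm {n : ℕ} (q : (Fin n → ℤ) × ℤ) (s : Fin n → ℂ) : ℂ :=
  ∑ i, (q.1 i : ℂ) * s i - (q.2 : ℂ)

/-- The hyperplanes `⟨μ, s⟩ = ν - l`, recorded as pairs `(μ, ν - l)`, where `μ` is the primitive
inward normal vector of a facet of `Δ_{C_J} + ℝⁿ_{≥0}` for some `J ⊆ [r]`, the facet lies on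
`⟨μ, σ⟩ = ν`, and `l` is a non-negative integer with `l ≤ ν - 1` in case `μ` is a vector of the
canonical basis. Different pairs give different hyperplanes, since `μ` is primitive with
non-negative coordinates. -/
def shintaniPolarHyperplanes {n r : ℕ} (A : Matrix (Fin n) (Fin r) ℝ) :
    Set ((Fin n → ℤ) × ℤ) :=
  {q | ∃ (J : Finset (Fin r)) (μ : Fin n → ℤ) (ν : ℤ) (l : ℕ),
    IsPrimitiveFacetNormal (newtonPolyhedron (columnProduct A J)) μ ν ∧
    (∀ i, μ = Pi.single i 1 → (l : ℤ) ≤ ν - 1) ∧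
    q = (μ, ν - (l : ℤ))}

/-- `F` is meromorphic on `ℂⁿ`: near every point it is a quotient `g / h` of holomorphic functions,
where `h` does not vanish identically near the point. (The values of `F` at the zeros of `h` are
irrelevant.) -/
def IsMeromorphicOnCn {n : ℕ} (F : (Fin n → ℂ) → ℂ) : Prop :=
  ∀ s₀ : Fin n → ℂ, ∃ g h : (Fin n → ℂ) → ℂ,
    AnalyticAt ℂ g s₀ ∧ AnalyticAt ℂ h s₀ ∧ (¬ ∀ᶠ s in 𝓝 s₀, h s = 0) ∧
    ∀ᶠ s in 𝓝 s₀, h s ≠ 0 → F s = g s / h s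

/-- The poles of `F` lie on the hyperplanes of the family `H` and are at most simple: near every
point `s₀`, after multiplication with finitely many of the affine forms of `H` vanishing at `s₀`,
each to the first power, `F` is holomorphic. In particular `F` is holomorphic near every point
that lies on none of the hyperplanes of `H`. -/
def HasAtMostSimplePolesAlong {n : ℕ} (F : (Fin n → ℂ) → ℂ) (H : Set ((Fin n → ℤ) × ℤ)) : Prop :=
  ∀ s₀ : Fin n → ℂ, ∃ T : Finset ((Fin n → ℤ) × ℤ),
    (∀ q ∈ T, q ∈ H ∧ hyperplaneForm q s₀ = 0) ∧
    ∃ g : (Fin n → ℂ) → ℂ, AnalyticAt ℂ g s₀ ∧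
      ∀ᶠ s in 𝓝 s₀, (∀ q ∈ T, hyperplaneForm q s ≠ 0) →
        (∏ q ∈ T, hyperplaneForm q s) * F s = g s

end

/-!
Multiplying the Shintani series by `∏ Γ(s_i)` turns it into the Mellin integral
`∫ ε ^ (s - 1) ∏_j 1 / (exp ℓ_j(ε) - 1) dε` over the positive orthant, where
`ℓ_j(ε) = ∑_i a_{ij} ε_i` (`summable_and_gamma_mul_shintaniZeta`). With `H(y) = y / (exp y - 1)`,
whose derivatives all decay exponentially, this integral belongs to the family of integrals of
`ε ^ (s - 1) ∏_j ℓ_j ^ (-k_j) H^{(p_j)}(ℓ_j)`. Such an integral converges when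
`∑_{i ∈ I} Re s_i > ∑_{j : B_j ⊆ I} k_j` for all non-empty `I ⊆ [n]`, where `B_j` is the support of
`ℓ_j` (`exists_exp_mul_norm_kernelProduct_le`). Both sides being additive over the connected
components of the hypergraph of the `B_j ⊆ I`, it is enough to require this for connected `I`.

Scaling the variables `ε_i`, `i ∈ I`, that is, integrating by parts in the logarithmic coordinates
`x_i = log ε_i` in the direction of the indicator of `I`, expresses
`(∑_{i ∈ I} s_i - ∑_{j : B_j ⊆ I} k_j)` times the integral through members of the family whose bound
at `I` is smaller by one and whose other bounds are not larger (`mellinIntegral_by_parts`). By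
induction every integral of the family continues to any half-space region after multiplication with
affine forms `∑_{i ∈ I} s_i - c`, `I` connected, each form being used only once
(`hasContinuation_mellinIntegral`). Dividing by `∏ Γ(s_i)` removes the forms `s_i - c` with `c ≤ 0`.

The product of the column forms over all of `[r]` already gives every hyperplane that is needed: the
polyhedron of `∏_j ℓ_j` lies in `∑_{i ∈ I} σ_i ≥ #{j | B_j ⊆ I}`, and for connected `I` equality
holds on a facet (`isPrimitiveFacetNormal_indicatorVector`). Finally the continuation agrees with
the series at every point of absolute convergence, since the series stays convergent and analytic
along the half-line `s + (t, …, t)`, `t > 0` (`eq_prod_polarForms_mul_of_summable`).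
-/


/-! ### Connected index sets and the facets of the Newton polyhedron -/

/-- The support `B_j = {i | 0 < a_{ij}}` of the linear form given by the `j`-th column of `A`. -/
noncomputable def columnSupport {n r : ℕ} (A : Matrix (Fin n) (Fin r) ℝ) (j : Fin r) :
    Finset (Fin n) :=
  {i | 0 < A i j}

/-- The total weight `∑ k_j` of those columns whose support lies in `I`. For `k = 1` this is the
minimum of `∑_{i ∈ I} σ_i` over the Newton polyhedron of the product of all the columns. -/
noncomputable def supportWeight {n r : ℕ} (A : Matrix (Fin n) (Fin r) ℝ) (k : Fin r → ℤ)
    (I : Finset (Fin n)) : ℤ :=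
  ∑ j with columnSupport A j ⊆ I, k j

/-- `I` is non-empty and connected as the vertex set of the hypergraph with edges the column
supports contained in `I`: no proper non-empty part of `I` is a union of components. -/
def IsConnectedSet {n r : ℕ} (A : Matrix (Fin n) (Fin r) ℝ) (I : Finset (Fin n)) : Prop :=
  I.Nonempty ∧ ∀ I₁ ⊆ I, I₁.Nonempty →
    (∀ j, columnSupport A j ⊆ I → columnSupport A j ⊆ I₁ ∨ Disjoint (columnSupport A j) I₁) →
    I₁ = I

section Facets

variable {n r : ℕ} {A : Matrix (Fin n) (Fin r) ℝ}

lemma mem_columnSupport {i : Fin n} {j : Fin r} : i ∈ columnSupport A j ↔ 0 < A i j := by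
  simp [columnSupport]

lemma columnSupport_nonempty (hA : A ∈ ShintaniMatrices n r) (j : Fin r) :
    (columnSupport A j).Nonempty :=
  let ⟨i, hi⟩ := hA.2.2 j
  ⟨i, mem_columnSupport.2 hi⟩

lemma eq_zero_of_notMem_columnSupport (hA : A ∈ ShintaniMatrices n r) {i : Fin n} {j : Fin r}
    (h : i ∉ columnSupport A j) : A i j = 0 :=
  le_antisymm (not_lt.1 fun h' => h (mem_columnSupport.2 h')) (hA.1 i j)

lemma supportWeight_eq_add_sdiff (hA : A ∈ ShintaniMatrices n r) (k : Fin r → ℤ)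
    {I I₁ : Finset (Fin n)} (h : I₁ ⊆ I)
    (hI : ∀ j, columnSupport A j ⊆ I →
      columnSupport A j ⊆ I₁ ∨ Disjoint (columnSupport A j) I₁) :
    supportWeight A k I = supportWeight A k I₁ + supportWeight A k (I \ I₁) := by
  unfold supportWeight
  rw [← Finset.sum_union]
  · congr 1
    ext j
    simp only [Finset.mem_filter, Finset.mem_univ, true_and, Finset.mem_union,
      Finset.subset_sdiff]
    exact ⟨fun hj => (hI j hj).imp id fun h' => ⟨hj, h'⟩,
      fun hj => hj.elim (fun h' => h'.trans h) (fun h' => h'.1)⟩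
  · rw [Finset.disjoint_left]
    intro j hj hj'
    simp only [Finset.mem_filter, Finset.mem_univ, true_and, Finset.subset_sdiff] at hj hj'
    obtain ⟨i, hi⟩ := columnSupport_nonempty hA j
    exact Finset.disjoint_left.1 hj'.2 hi (hj hi)

/-- The inequalities attached to connected sets imply those attached to all non-empty sets, because
both sides are additive over connected components. -/
lemma supportWeight_lt_sum_of_isConnectedSet (hA : A ∈ ShintaniMatrices n r) {k : Fin r → ℤ}
    {σ : Fin n → ℝ} (h : ∀ I, IsConnectedSet A I → (supportWeight A k I : ℝ) < ∑ i ∈ I, σ i)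
    (I : Finset (Fin n)) (hI : I.Nonempty) : (supportWeight A k I : ℝ) < ∑ i ∈ I, σ i := by
  induction I using Finset.strongInduction with
  | H I ih =>
    by_cases hc : IsConnectedSet A I
    · exact h I hc
    · simp only [IsConnectedSet, not_and, not_forall] at hc
      obtain ⟨I₁, h₁, hne, hs, hneq⟩ := hc hI
      have hss : I₁ ⊂ I := h₁.ssubset_of_ne hneq
      have e₁ := ih I₁ hss hne
      have e₂ := ih (I \ I₁) (Finset.sdiff_ssubset h₁ hne) (Finset.sdiff_nonempty.2 hss.2)
      rw [supportWeight_eq_add_sdiff hA k h₁ hs, ← Finset.sum_sdiff h₁]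
      push_cast
      linarith

/-- The exponent vector of the monomial of `∏_j ∑_i a_{ij} ε_i` obtained by choosing the variable
`c j` in the `j`-th factor. -/
def choiceExponent (c : Fin r → Fin n) (i : Fin n) : ℝ := ∑ j, if c j = i then 1 else 0

lemma columnProduct_univ (A : Matrix (Fin n) (Fin r) ℝ) :
    columnProduct A Finset.univ = ∑ c : Fin r → Fin n,
      MvPolynomial.monomial (∑ j, Finsupp.single (c j) 1) (∏ j, A (c j) j) := by
  unfold columnProduct
  rw [Finset.prod_univ_sum, Fintype.piFinset_univ]
  refine Finset.sum_congr rfl fun c _ => ?_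
  rw [MvPolynomial.monomial_sum_index, Finset.prod_mul_distrib, map_prod]
  rfl

lemma choiceExponent_eq (c : Fin r → Fin n) :
    (fun i => (((∑ j, Finsupp.single (c j) 1 : Fin n →₀ ℕ) i : ℕ) : ℝ)) = choiceExponent c := by
  funext i
  simp [choiceExponent, Finsupp.finsetSum_apply, Finsupp.single_apply]

lemma choiceExponent_mem_newtonPolyhedron (hA : A ∈ ShintaniMatrices n r) {c : Fin r → Fin n}
    (hc : ∀ j, c j ∈ columnSupport A j) {u : Fin n → ℝ} (hu : ∀ i, 0 ≤ u i) :
    choiceExponent c + u ∈ newtonPolyhedron (columnProduct A Finset.univ) := by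
  refine Set.add_mem_add (subset_convexHull ℝ _ ⟨∑ j, Finsupp.single (c j) 1, ?_,
    choiceExponent_eq c⟩) hu
  rw [Finset.mem_coe, MvPolynomial.mem_support_iff, columnProduct_univ, MvPolynomial.coeff_sum]
  refine ne_of_gt (Finset.sum_pos' (fun c' _ => ?_) ⟨c, Finset.mem_univ _, ?_⟩)
  · rw [MvPolynomial.coeff_monomial]
    split_ifs
    · exact Finset.prod_nonneg fun j _ => hA.1 _ _
    · rfl
  · rw [MvPolynomial.coeff_monomial, if_pos rfl]
    exact Finset.prod_pos fun j _ => mem_columnSupport.1 (hc j)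

lemma sum_choiceExponent (c : Fin r → Fin n) (I : Finset (Fin n)) :
    ∑ i ∈ I, choiceExponent c i = ∑ j, if c j ∈ I then 1 else 0 := by
  unfold choiceExponent
  rw [Finset.sum_comm]
  simp

lemma supportWeight_one_le_sum_choiceExponent {c : Fin r → Fin n}
    (hc : ∀ j, c j ∈ columnSupport A j) (I : Finset (Fin n)) :
    (supportWeight A 1 I : ℝ) ≤ ∑ i ∈ I, choiceExponent c i := by
  rw [sum_choiceExponent, supportWeight, Finset.sum_filter]
  push_cast
  refine Finset.sum_le_sum fun j _ => ?_
  by_cases h : columnSupport A j ⊆ I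
  · simp [h, h (hc j)]
  · simp only [h, if_false]
    split_ifs <;> norm_num

lemma supportWeight_one_le_of_mem_newtonPolyhedron (hA : A ∈ ShintaniMatrices n r)
    {σ : Fin n → ℝ} (hσ : σ ∈ newtonPolyhedron (columnProduct A Finset.univ))
    (I : Finset (Fin n)) : (supportWeight A 1 I : ℝ) ≤ ∑ i ∈ I, σ i := by
  obtain ⟨x, hx, u, hu, rfl⟩ := hσ
  have key : x ∈ {y : Fin n → ℝ | (supportWeight A 1 I : ℝ) ≤ ∑ i ∈ I, y i} := by
    refine convexHull_min ?_ ?_ hx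
    · rintro _ ⟨α, hα, rfl⟩
      rw [Finset.mem_coe, MvPolynomial.mem_support_iff, columnProduct_univ,
        MvPolynomial.coeff_sum] at hα
      obtain ⟨c, -, hc⟩ := Finset.exists_ne_zero_of_sum_ne_zero hα
      rw [MvPolynomial.coeff_monomial] at hc
      split_ifs at hc with h
      · subst h
        simp only [Set.mem_ofPred_eq]
        have := supportWeight_one_le_sum_choiceExponent (A := A) (c := c) (fun j => by
          by_contra h'
          exact hc (Finset.prod_eq_zero (Finset.mem_univ j)
            (eq_zero_of_notMem_columnSupport hA h'))) I
        rwa [← choiceExponent_eq c] at this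
      · exact absurd rfl hc
    · have hlin : IsLinearMap ℝ (fun y : Fin n → ℝ => ∑ i ∈ I, y i) :=
        ⟨fun a b => by simp [Finset.sum_add_distrib], fun a b => by simp [Finset.mul_sum]⟩
      exact convex_halfSpace_ge hlin _
  simp only [Set.mem_ofPred_eq] at key
  simp only [Pi.add_apply, Finset.sum_add_distrib]
  exact key.trans (le_add_of_nonneg_right (Finset.sum_nonneg fun i _ => hu i))

/-- The indicator vector of `I`. -/
def indicatorVector (I : Finset (Fin n)) (i : Fin n) : ℤ := if i ∈ I then 1 else 0

lemma sum_indicatorVector_mul {R : Type*} [CommRing R] (I : Finset (Fin n)) (σ : Fin n → R) :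
    ∑ i, (indicatorVector I i : R) * σ i = ∑ i ∈ I, σ i := by
  simp [indicatorVector, Finset.sum_ite_mem]

/-- The functional `v ↦ ∑_{i ∈ I} v_i`. -/
def sumFunctional (I : Finset (Fin n)) : Module.Dual ℝ (Fin n → ℝ) :=
  ∑ i ∈ I, LinearMap.proj i

lemma sumFunctional_apply (I : Finset (Fin n)) (v : Fin n → ℝ) :
    sumFunctional I v = ∑ i ∈ I, v i := by simp [sumFunctional]

lemma choiceExponent_mem_faceOf (hA : A ∈ ShintaniMatrices n r) {I : Finset (Fin n)}
    {c : Fin r → Fin n} (hc : ∀ j, c j ∈ columnSupport A j)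
    (hcI : ∀ j, ¬ columnSupport A j ⊆ I → c j ∉ I) {u : Fin n → ℝ} (hu : ∀ i, 0 ≤ u i)
    (huI : ∀ i ∈ I, u i = 0) :
    choiceExponent c + u ∈ faceOf (newtonPolyhedron (columnProduct A Finset.univ))
      (indicatorVector I) (supportWeight A 1 I) := by
  refine ⟨choiceExponent_mem_newtonPolyhedron hA hc hu, ?_⟩
  rw [sum_indicatorVector_mul]
  simp only [Pi.add_apply, Finset.sum_add_distrib]
  rw [Finset.sum_eq_zero huI, add_zero, sum_choiceExponent, supportWeight, Finset.sum_filter]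
  push_cast
  refine Finset.sum_congr rfl fun j _ => ?_
  by_cases h : columnSupport A j ⊆ I
  · simp [h, h (hc j)]
  · simp [h, hcI j h]

/-- Every connected set `I` gives a facet of the Newton polyhedron of the product of all columns,
with normal vector the indicator of `I`. The dimension is found by duality: a functional vanishing
on the directions of the face vanishes on `e_i` for `i ∉ I` (move along the recession cone), and is
constant on every column support inside `I` (exchange the variable chosen in one factor), hence is
constant on `I`. -/
theorem isPrimitiveFacetNormal_indicatorVector (hA : A ∈ ShintaniMatrices n r)
    {I : Finset (Fin n)} (hI : IsConnectedSet A I) :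
    IsPrimitiveFacetNormal (newtonPolyhedron (columnProduct A Finset.univ))
      (indicatorVector I) (supportWeight A 1 I) := by
  classical
  set F := faceOf (newtonPolyhedron (columnProduct A Finset.univ))
      (indicatorVector I) (supportWeight A 1 I) with hF
  have hchoice : ∀ j, ∃ i ∈ columnSupport A j, ¬ columnSupport A j ⊆ I → i ∉ I := by
    intro j
    by_cases h : columnSupport A j ⊆ I
    · obtain ⟨i, hi⟩ := columnSupport_nonempty hA j
      exact ⟨i, hi, fun h' => absurd h h'⟩
    · obtain ⟨i, hi, hi'⟩ := Finset.not_subset.1 h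
      exact ⟨i, hi, fun _ => hi'⟩
  choose c hc hcI using hchoice
  have hmem : choiceExponent c ∈ F := by
    simpa using choiceExponent_mem_faceOf hA hc hcI (u := 0) (by simp) (by simp)
  obtain ⟨i₀, hi₀⟩ := hI.1
  have hspan : vectorSpan ℝ F = LinearMap.ker (sumFunctional I) := by
    apply le_antisymm
    · rw [vectorSpan_def, Submodule.span_le]
      rintro _ ⟨x, hx, y, hy, rfl⟩
      have h1 := hx.2
      have h2 := hy.2
      rw [sum_indicatorVector_mul] at h1 h2
      simp [sumFunctional_apply, h1, h2]
    · intro v hv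
      rw [LinearMap.mem_ker, sumFunctional_apply] at hv
      rw [← Subspace.forall_mem_dualAnnihilator_apply_eq_zero_iff]
      intro φ hφ
      rw [Submodule.mem_dualAnnihilator] at hφ
      have hφ' : ∀ x ∈ F, φ x = φ (choiceExponent c) := fun x hx => by
        have := hφ _ (vsub_mem_vectorSpan ℝ hx hmem)
        rw [vsub_eq_sub, map_sub] at this
        linarith
      have hout : ∀ i, i ∉ I → φ (Pi.single i 1) = 0 := fun i hi => by
        have := hφ' _ (choiceExponent_mem_faceOf hA hc hcI (u := Pi.single i 1)
          (fun i' => by by_cases h : i' = i <;> simp [h])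
          (fun i' hi' => Pi.single_eq_of_ne (show i' ≠ i by rintro rfl; exact hi hi') _))
        rw [map_add] at this
        linarith
      have hconst : ∀ j, columnSupport A j ⊆ I → ∀ i ∈ columnSupport A j,
          φ (Pi.single i 1) = φ (Pi.single (c j) 1) := fun j hj i hi => by
        have h1 := hφ' _ (choiceExponent_mem_faceOf hA (I := I) (c := Function.update c j i)
          (u := 0)
          (fun j' => by
            by_cases h : j' = j
            · subst h; simpa using hi
            · simpa [h] using hc j')
          (fun j' hj' => by
            have h : j' ≠ j := fun h => hj' (h ▸ hj)
            simpa [h] using hcI j' hj') (by simp) (by simp))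
        have h2 : choiceExponent (Function.update c j i) + 0 =
            choiceExponent c + (Pi.single i 1 - Pi.single (c j) 1) := by
          funext a
          simp only [choiceExponent, Pi.zero_apply, add_zero, Pi.add_apply, Pi.sub_apply]
          rw [← Finset.add_sum_erase _ _ (Finset.mem_univ j),
            ← Finset.add_sum_erase _ (fun j => if c j = a then (1 : ℝ) else 0)
              (Finset.mem_univ j)]
          have : ∀ j' ∈ Finset.univ.erase j,
              (if Function.update c j i j' = a then (1 : ℝ) else 0) = if c j' = a then 1 else 0 :=
            fun j' hj' => by rw [Function.update_of_ne (Finset.ne_of_mem_erase hj')]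
          rw [Finset.sum_congr rfl this]
          simp only [Function.update_self, Pi.single_apply, eq_comm (a := a)]
          ring
        rw [h2, map_add, map_sub] at h1
        linarith
      have hI₁ := hI.2 (I.filter fun i => φ (Pi.single i 1) = φ (Pi.single i₀ 1))
        (Finset.filter_subset _ _) ⟨i₀, by simp [hi₀]⟩ (fun j hj => by
          by_cases h : φ (Pi.single (c j) 1) = φ (Pi.single i₀ 1)
          · left
            intro i hi
            simp [hj hi, hconst j hj i hi, h]
          · right
            rw [Finset.disjoint_left]
            intro i hi
            simp [hconst j hj i hi, h])
      have hin : ∀ i ∈ I, φ (Pi.single i 1) = φ (Pi.single i₀ 1) := fun i hi => by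
        rw [← hI₁] at hi
        exact (Finset.mem_filter.1 hi).2
      have hv' : φ v = ∑ i, v i * φ (Pi.single i 1) := by
        conv_lhs => rw [pi_eq_sum_univ' v]
        simp [map_sum]
      rw [hv', ← Finset.sum_subset (Finset.subset_univ I)
        (fun i _ hi => by rw [hout i hi, mul_zero]),
        Finset.sum_congr rfl (fun i hi => by rw [hin i hi]), ← Finset.sum_mul, hv, zero_mul]
  refine ⟨?_, ?_, ⟨_, hmem⟩, ?_⟩
  · have h1 : Finset.univ.gcd (indicatorVector I) ∣ 1 := by
      have := Finset.gcd_dvd (f := indicatorVector I) (Finset.mem_univ i₀)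
      simpa [indicatorVector, hi₀] using this
    have h2 := Finset.normalize_gcd (s := Finset.univ) (f := indicatorVector I)
    rw [← h2]
    exact normalize_eq_one.2 (isUnit_of_dvd_one h1)
  · intro σ hσ
    rw [sum_indicatorVector_mul]
    exact supportWeight_one_le_of_mem_newtonPolyhedron hA hσ I
  · rw [← hF, hspan]
    have hne : sumFunctional I ≠ 0 := fun h => by
      have := congrArg (fun φ => φ (Pi.single i₀ 1)) h
      simp [sumFunctional_apply, hi₀] at this
    have := Module.Dual.finrank_ker_add_one_of_ne_zero (f := sumFunctional I) hne
    simpa using this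

end Facets

/-! ### The function `z / (exp z - 1)` and its derivatives -/

/-- The function `z / (exp z - 1)`, with value `1` at `z = 0`. -/
noncomputable def bernoulliKernel (z : ℂ) : ℂ := (dslope Complex.exp 0 z)⁻¹

lemma bernoulliKernel_of_ne_zero {z : ℂ} (hz : z ≠ 0) :
    bernoulliKernel z = z / (Complex.exp z - 1) := by
  rw [bernoulliKernel, dslope_of_ne _ hz, slope_def_field]
  simp

lemma dslope_exp_ne_zero {z : ℂ} (hz : |z.im| < 2 * Real.pi) : dslope Complex.exp 0 z ≠ 0 := by
  rcases eq_or_ne z 0 with rfl | h0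
  · simp [dslope_same]
  · rw [dslope_of_ne _ h0, slope_def_field, sub_zero, Complex.exp_zero]
    refine div_ne_zero (fun h => ?_) h0
    obtain ⟨m, hm⟩ := Complex.exp_eq_one_iff.1 (sub_eq_zero.1 h)
    have him : z.im = m * (2 * Real.pi) := by
      rw [hm]
      simp
    have hm0 : m = 0 := by
      rw [him, abs_mul, abs_of_pos Real.two_pi_pos] at hz
      have : |(m : ℝ)| < 1 := by
        by_contra h'
        nlinarith [Real.two_pi_pos, not_lt.1 h']
      rw [← Int.cast_abs] at this
      exact Int.abs_lt_one_iff.1 (by exact_mod_cast this)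
    exact h0 (by rw [hm, hm0]; simp)

lemma differentiableAt_bernoulliKernel {z : ℂ} (hz : |z.im| < 2 * Real.pi) :
    DifferentiableAt ℂ bernoulliKernel z := by
  have h : DifferentiableOn ℂ (dslope Complex.exp 0) Set.univ :=
    (Complex.differentiableOn_dslope Filter.univ_mem).2 Complex.differentiable_exp.differentiableOn
  exact (h.differentiableAt Filter.univ_mem).inv (dslope_exp_ne_zero hz)

lemma analyticAt_bernoulliKernel_ofReal (y : ℝ) : AnalyticAt ℂ bernoulliKernel y := by
  have ho : IsOpen {z : ℂ | |z.im| < 2 * Real.pi} :=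
    isOpen_lt (Complex.continuous_im.abs) continuous_const
  have hd : DifferentiableOn ℂ bernoulliKernel {z : ℂ | |z.im| < 2 * Real.pi} :=
    fun z hz => (differentiableAt_bernoulliKernel hz).differentiableWithinAt
  exact hd.analyticAt (ho.mem_nhds (by simp [Real.pi_pos]))

lemma hasDerivAt_iteratedDeriv_bernoulliKernel (p : ℕ) (y : ℝ) :
    HasDerivAt (fun t : ℝ => iteratedDeriv p bernoulliKernel t)
      (iteratedDeriv (p + 1) bernoulliKernel y) y := by
  rw [iteratedDeriv_succ]
  have h := (analyticAt_bernoulliKernel_ofReal y).iterated_deriv p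
  rw [← iteratedDeriv_eq_iterate] at h
  exact h.differentiableAt.hasDerivAt.comp_ofReal

lemma exists_norm_bernoulliKernel_le :
    ∃ K : ℝ, 0 < K ∧ ∀ (y : ℝ) (z : ℂ), 0 ≤ y → ‖z - y‖ ≤ 1 →
      ‖bernoulliKernel z‖ ≤ K * Real.exp (-(1 / 2) * y) := by
  have hpi : (1 : ℝ) < 2 * Real.pi := by linarith [Real.two_le_pi]
  have hc : IsCompact (Metric.closedBall (0 : ℂ) 3 ∩ {z | |z.im| ≤ 1}) :=
    (isCompact_closedBall _ _).inter_right
      (isClosed_le (Complex.continuous_im.abs) continuous_const)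
  obtain ⟨K₀, hK₀⟩ := hc.exists_bound_of_continuousOn (f := bernoulliKernel) fun z hz =>
    (differentiableAt_bernoulliKernel (hz.2.trans_lt hpi)).continuousAt.continuousWithinAt
  refine ⟨max (K₀ * Real.exp 1) (4 * Real.exp 1), by positivity, fun y z hy hz => ?_⟩
  have hre : |z.re - y| ≤ 1 := by
    simpa using (Complex.abs_re_le_norm (z - y)).trans hz
  have him : |z.im| ≤ 1 := by
    simpa using (Complex.abs_im_le_norm (z - y)).trans hz
  have hzy : ‖z‖ ≤ y + 1 := by
    have := norm_add_le (z - y) y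
    rw [sub_add_cancel, Complex.norm_real, Real.norm_of_nonneg hy] at this
    linarith
  rcases le_total y 2 with h2 | h2
  · have h1 := hK₀ z ⟨by simpa using hzy.trans (by linarith), him⟩
    have hK : 0 ≤ K₀ := (norm_nonneg _).trans h1
    calc ‖bernoulliKernel z‖ ≤ K₀ * 1 := by simpa using h1
      _ ≤ K₀ * (Real.exp 1 * Real.exp (-(1 / 2) * y)) := by
        rw [← Real.exp_add]
        gcongr
        exact Real.one_le_exp (by linarith)
      _ ≤ _ := by
        rw [← mul_assoc]
        gcongr
        exact le_max_left _ _
  · have hr := abs_le.1 hre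
    have hz0 : z ≠ 0 := fun h => by
      rw [h] at hr
      simp at hr
      linarith
    have hE : Real.exp (y - 1) / 2 ≤ ‖Complex.exp z - 1‖ := by
      have h1 := norm_sub_norm_le (Complex.exp z) 1
      rw [Complex.norm_exp, norm_one] at h1
      have h3 : Real.exp (y - 1) ≤ Real.exp z.re := Real.exp_le_exp.2 (by linarith)
      have h4 : (y - 1) + 1 ≤ Real.exp (y - 1) := Real.add_one_le_exp _
      linarith
    rw [bernoulliKernel_of_ne_zero hz0, norm_div]
    have hy2 : y + 1 ≤ 2 * Real.exp (y / 2) := by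
      linarith [Real.add_one_le_exp (y / 2)]
    calc ‖z‖ / ‖Complex.exp z - 1‖ ≤ (2 * Real.exp (y / 2)) / (Real.exp (y - 1) / 2) := by
          gcongr
          exact hzy.trans hy2
      _ = 4 * Real.exp 1 * Real.exp (-(1 / 2) * y) := by
        rw [div_eq_iff (by positivity)]
        have : Real.exp (y / 2) = Real.exp 1 * Real.exp (-(1 / 2) * y) * Real.exp (y - 1) := by
          rw [← Real.exp_add, ← Real.exp_add]
          ring_nf
        rw [this]
        ring
      _ ≤ _ := by
        gcongr
        exact le_max_right _ _

/-- All derivatives of `z / (exp z - 1)` decay exponentially on `[0, ∞)`, by the Cauchy estimates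
on discs of radius `1`. -/
lemma exists_norm_iteratedDeriv_bernoulliKernel_le (p : ℕ) :
    ∃ K : ℝ, 0 < K ∧ ∀ y : ℝ, 0 ≤ y →
      ‖iteratedDeriv p bernoulliKernel y‖ ≤ K * Real.exp (-(1 / 2) * y) := by
  obtain ⟨K, hK, h⟩ := exists_norm_bernoulliKernel_le
  refine ⟨p.factorial * K, by positivity, fun y hy => ?_⟩
  have hpi : (1 : ℝ) < 2 * Real.pi := by linarith [Real.two_le_pi]
  have hd : DiffContOnCl ℂ bernoulliKernel (Metric.ball (y : ℂ) 1) := by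
    refine DifferentiableOn.diffContOnCl fun z hz => ?_
    have hz' := Metric.closure_ball_subset_closedBall hz
    rw [mem_closedBall_iff_norm] at hz'
    refine (differentiableAt_bernoulliKernel (lt_of_le_of_lt ?_ hpi)).differentiableWithinAt
    simpa using (Complex.abs_im_le_norm (z - y)).trans hz'
  have := Complex.norm_iteratedDeriv_le_of_forall_mem_sphere_norm_le p one_pos hd
    (fun z hz => h y z hy (mem_sphere_iff_norm.1 hz).le)
  simpa [mul_assoc] using this

/-! ### Convergence of the Mellin integrals in logarithmic coordinates -/

/-- The linear form `∑_i a_{ij} ε_i` in the logarithmic coordinates `ε_i = exp x_i`. -/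
noncomputable def columnForm {n r : ℕ} (A : Matrix (Fin n) (Fin r) ℝ) (j : Fin r)
    (x : Fin n → ℝ) : ℝ :=
  ∑ i, A i j * Real.exp (x i)

/-- The function `∏_j ℓ_j ^ (-k_j) * H_j(ℓ_j)`, where `ℓ_j` is the `j`-th column form and `H_j` is
the derivative of order `p_j` of `z / (exp z - 1)`. -/
noncomputable def kernelProduct {n r : ℕ} (A : Matrix (Fin n) (Fin r) ℝ) (k : Fin r → ℤ)
    (p : Fin r → ℕ) (x : Fin n → ℝ) : ℂ :=
  ∏ j, (columnForm A j x : ℂ) ^ (-k j) *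
    iteratedDeriv (p j) bernoulliKernel (columnForm A j x)

section Convergence

variable {n r : ℕ} {A : Matrix (Fin n) (Fin r) ℝ}

lemma integrable_exp_neg_mul_norm {E : Type*} [NormedAddCommGroup E] [NormedSpace ℝ E]
    [FiniteDimensional ℝ E] [MeasurableSpace E] [BorelSpace E] (μ : MeasureTheory.Measure E)
    [μ.IsAddHaarMeasure] {δ : ℝ} (hδ : 0 < δ) :
    MeasureTheory.Integrable (fun x : E => Real.exp (-δ * ‖x‖)) μ := by
  set N := Module.finrank ℝ E + 1 with hN
  have hN0 : (0 : ℝ) < N := by positivity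
  have hint := integrable_one_add_norm (E := E) (μ := μ) (r := (N : ℝ)) (by simp [hN])
  set c := δ / N with hc
  have hc0 : 0 < c := by positivity
  refine (hint.const_mul ((1 + 1 / c) ^ N)).mono' (by fun_prop) (.of_forall fun x => ?_)
  rw [Real.norm_of_nonneg (Real.exp_pos _).le, Real.rpow_neg (by positivity),
    Real.rpow_natCast, ← div_eq_mul_inv, le_div_iff₀ (by positivity)]
  have h1 : 1 + ‖x‖ ≤ (1 + 1 / c) * Real.exp (c * ‖x‖) := by
    have := Real.add_one_le_exp (c * ‖x‖)
    calc 1 + ‖x‖ ≤ 1 + ‖x‖ + (c * ‖x‖ + 1 / c) := le_add_of_nonneg_right (by positivity)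
      _ = (1 + 1 / c) * (c * ‖x‖ + 1) := by field_simp; ring
      _ ≤ _ := by gcongr
  calc Real.exp (-δ * ‖x‖) * (1 + ‖x‖) ^ N
      ≤ Real.exp (-δ * ‖x‖) * ((1 + 1 / c) * Real.exp (c * ‖x‖)) ^ N := by gcongr
    _ = (1 + 1 / c) ^ N * (Real.exp (-δ * ‖x‖) * Real.exp (c * ‖x‖) ^ N) := by
      rw [mul_pow]
      ring
    _ = (1 + 1 / c) ^ N := by
      rw [← Real.exp_nat_mul, ← Real.exp_add, hc]
      field_simp
      simp

lemma integral_indicator_le_const {a T : ℝ} (h0 : 0 ≤ a) (hT : a ≤ T) :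
    ∫ t in (0 : ℝ)..T, (if t ≤ a then (1 : ℝ) else 0) = a := by
  have := intervalIntegral.integral_indicator (μ := MeasureTheory.volume)
    (f := fun _ => (1 : ℝ)) (a₁ := 0) (a₂ := a) (a₃ := T) ⟨h0, hT⟩
  simpa [Set.indicator_apply] using this

lemma intervalIntegrable_indicator_le (a T : ℝ) :
    IntervalIntegrable (fun t : ℝ => if t ≤ a then (1 : ℝ) else 0) MeasureTheory.volume 0 T := by
  have h : Antitone (fun t : ℝ => if t ≤ a then (1 : ℝ) else 0) := fun s t hst => by
    by_cases h : t ≤ a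
    · simp [h, hst.trans h]
    · simp only [h, if_false]
      split_ifs <;> norm_num
  exact h.intervalIntegrable

lemma intervalIntegrable_sum_indicator_le {ι : Type*} (s : Finset ι) (w b : ι → ℝ) (T : ℝ) :
    IntervalIntegrable (fun t : ℝ => ∑ i ∈ s, w i * (if t ≤ b i then (1 : ℝ) else 0))
      MeasureTheory.volume 0 T := by
  have h : IntervalIntegrable (∑ i ∈ s, fun t : ℝ => w i * (if t ≤ b i then (1 : ℝ) else 0))
      MeasureTheory.volume 0 T :=
    IntervalIntegrable.sum _ fun i _ => (intervalIntegrable_indicator_le _ _).const_mul _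
  convert h using 1
  ext t
  simp

/-- The layer-cake argument behind convergence: the piecewise linear function
`a ↦ ∑ σ_i a_i - ∑ k_j min_{B_j} a` is the integral over `t` of its values
`∑_{I_t} σ_i - (weight of I_t)` on the indicators of the superlevel sets `I_t = {t ≤ a_i}`. -/
lemma mul_norm_le_sum_sub_sum_inf' (hA : A ∈ ShintaniMatrices n r) {k : Fin r → ℤ}
    {σ : Fin n → ℝ} {δ : ℝ} (h : ∀ I : Finset (Fin n), I.Nonempty →
      (supportWeight A k I : ℝ) + δ ≤ ∑ i ∈ I, σ i) {a : Fin n → ℝ} (ha : ∀ i, 0 ≤ a i) :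
    δ * ‖a‖ ≤ ∑ i, σ i * a i -
      ∑ j, (k j : ℝ) * (columnSupport A j).inf' (columnSupport_nonempty hA j) a := by
  set T := ‖a‖ with hT
  have haT : ∀ i, a i ≤ T := fun i => (le_abs_self _).trans (norm_le_pi_norm a i)
  have hm0 : ∀ j, 0 ≤ (columnSupport A j).inf' (columnSupport_nonempty hA j) a := fun j =>
    Finset.le_inf' _ _ fun i _ => ha i
  have hmT : ∀ j, (columnSupport A j).inf' (columnSupport_nonempty hA j) a ≤ T := fun j => by
    obtain ⟨i, hi⟩ := columnSupport_nonempty hA j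
    exact (Finset.inf'_le a hi).trans (haT i)
  have hint : ∫ t in (0 : ℝ)..T, (∑ i, σ i * (if t ≤ a i then (1 : ℝ) else 0) -
      ∑ j, (k j : ℝ) * (if t ≤ (columnSupport A j).inf' (columnSupport_nonempty hA j) a
        then (1 : ℝ) else 0)) = ∑ i, σ i * a i -
      ∑ j, (k j : ℝ) * (columnSupport A j).inf' (columnSupport_nonempty hA j) a := by
    rw [intervalIntegral.integral_sub, intervalIntegral.integral_finsetSum,
      intervalIntegral.integral_finsetSum]
    · simp only [intervalIntegral.integral_const_mul]
      congr 1
      · exact Finset.sum_congr rfl fun i _ => by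
          rw [integral_indicator_le_const (ha i) (haT i)]
      · exact Finset.sum_congr rfl fun j _ => by
          rw [integral_indicator_le_const (hm0 j) (hmT j)]
    · exact fun j _ => (intervalIntegrable_indicator_le _ _).const_mul _
    · exact fun i _ => (intervalIntegrable_indicator_le _ _).const_mul _
    · exact intervalIntegrable_sum_indicator_le _ _ _ _
    · exact intervalIntegrable_sum_indicator_le _ _ _ _
  rw [← hint]
  have hconst : δ * T = ∫ t in (0 : ℝ)..T, δ := by simp [mul_comm]
  rw [hconst]
  refine intervalIntegral.integral_mono_on_of_le_Ioo (norm_nonneg _) (by simp)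
    ((intervalIntegrable_sum_indicator_le _ _ _ _).sub
      (intervalIntegrable_sum_indicator_le _ _ _ _)) fun t ht => ?_
  have hne : (Finset.univ.filter fun i => t ≤ a i).Nonempty := by
    by_contra hne
    rw [Finset.not_nonempty_iff_eq_empty, Finset.filter_eq_empty_iff] at hne
    refine lt_irrefl T (lt_trans ((pi_norm_lt_iff ht.1).2 fun i => ?_) ht.2)
    rw [Real.norm_of_nonneg (ha i)]
    exact not_le.1 (hne (Finset.mem_univ i))
  have h1 := h _ hne
  have h2 : ∑ j, (k j : ℝ) * (if t ≤ (columnSupport A j).inf' (columnSupport_nonempty hA j) a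
      then (1 : ℝ) else 0) = supportWeight A k (Finset.univ.filter fun i => t ≤ a i) := by
    rw [supportWeight, Finset.sum_filter]
    push_cast
    refine Finset.sum_congr rfl fun j _ => ?_
    simp [Finset.le_inf'_iff, Finset.subset_iff]
  rw [h2]
  rw [Finset.sum_filter] at h1
  simp only [mul_ite, mul_one, mul_zero]
  linarith

lemma columnForm_pos (hA : A ∈ ShintaniMatrices n r) (j : Fin r) (x : Fin n → ℝ) :
    0 < columnForm A j x := by
  obtain ⟨i, hi⟩ := hA.2.2 j
  exact Finset.sum_pos' (fun i _ => mul_nonneg (hA.1 i j) (Real.exp_pos _).le)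
    ⟨i, Finset.mem_univ i, mul_pos hi (Real.exp_pos _)⟩

lemma continuous_columnForm (j : Fin r) : Continuous (columnForm A j) := by
  unfold columnForm
  fun_prop

/-- Any integral power of a column form is at most a constant times the same power of
`exp (max_{B_j} x_i)`, when `x_i = -a_i ≤ 0`; the positive parts of the `x_i` contribute a
factor growing at most exponentially. -/
lemma exists_columnForm_zpow_le (hA : A ∈ ShintaniMatrices n r) (j : Fin r) (k : ℤ) :
    ∃ K : ℝ, 0 < K ∧ ∀ x : Fin n → ℝ, columnForm A j x ^ (-k) ≤
      K * Real.exp (|(k : ℝ)| * ∑ i, max (x i) 0 +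
        k * (columnSupport A j).inf' (columnSupport_nonempty hA j) (fun i => max (-x i) 0)) := by
  set m : (Fin n → ℝ) → ℝ := fun x =>
    (columnSupport A j).inf' (columnSupport_nonempty hA j) (fun i => max (-x i) 0) with hm
  have hX : ∀ x : Fin n → ℝ, 0 ≤ ∑ i, max (x i) 0 := fun x =>
    Finset.sum_nonneg fun i _ => le_max_right _ _
  rcases le_total 0 k with hk | hk
  · obtain ⟨k, rfl⟩ := Int.eq_ofNat_of_zero_le hk
    obtain ⟨i₁, hi₁, hc⟩ := (columnSupport A j).exists_min_image (fun i => A i j)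
      (columnSupport_nonempty hA j)
    have hc0 : 0 < A i₁ j := mem_columnSupport.1 hi₁
    refine ⟨(A i₁ j ^ k)⁻¹, by positivity, fun x => ?_⟩
    have hlow : A i₁ j * Real.exp (-m x) ≤ columnForm A j x := by
      obtain ⟨i₂, hi₂, he⟩ := (columnSupport A j).exists_mem_eq_inf'
        (columnSupport_nonempty hA j) (fun i => max (-x i) 0)
      have h1 : A i₂ j * Real.exp (x i₂) ≤ columnForm A j x :=
        Finset.single_le_sum (f := fun i => A i j * Real.exp (x i))
          (fun i _ => mul_nonneg (hA.1 i j) (Real.exp_pos _).le) (Finset.mem_univ i₂)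
      refine le_trans ?_ h1
      have h2 : -m x ≤ x i₂ := by
        rw [hm]
        simp only [he]
        linarith [le_max_left (-x i₂) 0]
      exact mul_le_mul (hc i₂ hi₂) (Real.exp_le_exp.2 h2) (Real.exp_pos _).le (hA.1 _ _)
    rw [zpow_neg, zpow_natCast]
    calc (columnForm A j x ^ k)⁻¹ ≤ ((A i₁ j * Real.exp (-m x)) ^ k)⁻¹ := by gcongr
      _ = (A i₁ j ^ k)⁻¹ * Real.exp (k * m x) := by
        rw [mul_pow, mul_inv, ← Real.exp_nat_mul, ← Real.exp_neg]
        ring_nf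
      _ ≤ _ := by
        gcongr
        push_cast
        exact le_add_of_nonneg_left (mul_nonneg (abs_nonneg _) (hX x))
  · obtain ⟨k, rfl⟩ := Int.exists_eq_neg_ofNat hk
    have hS : 0 < ∑ i, A i j := by
      obtain ⟨i, hi⟩ := hA.2.2 j
      exact Finset.sum_pos' (fun i _ => hA.1 i j) ⟨i, Finset.mem_univ i, hi⟩
    refine ⟨(∑ i, A i j) ^ k, by positivity, fun x => ?_⟩
    have hup : columnForm A j x ≤ (∑ i, A i j) * Real.exp (∑ i, max (x i) 0 - m x) := by
      rw [columnForm, Finset.sum_mul]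
      refine Finset.sum_le_sum fun i _ => ?_
      by_cases hi : i ∈ columnSupport A j
      · refine mul_le_mul_of_nonneg_left (Real.exp_le_exp.2 ?_) (hA.1 _ _)
        have h1 : m x ≤ max (-x i) 0 := Finset.inf'_le _ hi
        have h2 : max (x i) 0 ≤ ∑ i, max (x i) 0 :=
          Finset.single_le_sum (f := fun i => max (x i) 0) (fun i _ => le_max_right _ _)
            (Finset.mem_univ i)
        have h3 : x i = max (x i) 0 - max (-x i) 0 := by
          rcases le_total 0 (x i) with h | h
          · rw [max_eq_left h, max_eq_right (by linarith)]; ring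
          · rw [max_eq_right h, max_eq_left (by linarith)]; ring
        linarith
      · simp [eq_zero_of_notMem_columnSupport hA hi]
    rw [neg_neg, zpow_natCast]
    calc columnForm A j x ^ k ≤ ((∑ i, A i j) * Real.exp (∑ i, max (x i) 0 - m x)) ^ k := by
          have := (columnForm_pos hA j x).le
          gcongr
      _ = _ := by
        rw [mul_pow, ← Real.exp_nat_mul]
        push_cast
        rw [abs_neg, Nat.abs_cast]
        simp only [hm]
        ring_nf

lemma exists_pos_forall_le {ι : Type*} [Finite ι] {P : ι → Prop} (f : ι → ℝ)
    (hf : ∀ i, P i → 0 < f i) : ∃ c : ℝ, 0 < c ∧ ∀ i, P i → c ≤ f i := by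
  classical
  cases nonempty_fintype ι
  rcases (Finset.univ.filter P).eq_empty_or_nonempty with h | h
  · exact ⟨1, one_pos, fun i hi => absurd hi (Finset.filter_eq_empty_iff.1 h (Finset.mem_univ i))⟩
  · obtain ⟨i, hi, hmin⟩ := Finset.exists_min_image _ f h
    exact ⟨f i, hf i (Finset.mem_filter.1 hi).2, fun j hj => hmin j (by simp [hj])⟩

/-- The integrand of the Mellin integral decays exponentially in all directions, provided that
`∑_{i ∈ I} σ_i` exceeds the weight of `I` for all non-empty `I`. -/
theorem exists_exp_mul_norm_kernelProduct_le (hA : A ∈ ShintaniMatrices n r) {k : Fin r → ℤ}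
    (p : Fin r → ℕ) {σ : Fin n → ℝ}
    (h : ∀ I : Finset (Fin n), I.Nonempty → (supportWeight A k I : ℝ) < ∑ i ∈ I, σ i) :
    ∃ K δ : ℝ, 0 < δ ∧ ∀ x : Fin n → ℝ,
      Real.exp (∑ i, σ i * x i) * ‖kernelProduct A k p x‖ ≤ K * Real.exp (-δ * ‖x‖) := by
  obtain ⟨δ, hδ, hδI⟩ := exists_pos_forall_le (P := fun I : Finset (Fin n) => I.Nonempty)
    (fun I => ∑ i ∈ I, σ i - supportWeight A k I) (fun I hI => sub_pos.2 (h I hI))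
  obtain ⟨c, hc, hcR⟩ := exists_pos_forall_le (P := fun _ : Fin n => True)
    (fun i => ∑ j, A i j) (fun i _ => by
      obtain ⟨j, hj⟩ := hA.2.1 i
      exact Finset.sum_pos' (fun j _ => hA.1 i j) ⟨j, Finset.mem_univ j, hj⟩)
  choose K hK hKx using fun j => exists_columnForm_zpow_le hA j (k j)
  choose L hL hLx using fun j => exists_norm_iteratedDeriv_bernoulliKernel_le (p j)
  set N : ℝ := ∑ j, |(k j : ℝ)| + ∑ i, |σ i| + δ with hN
  have hN0 : 0 ≤ N := by positivity
  refine ⟨(∏ j, K j * L j) * Real.exp (n * (N ^ 2 / c)), δ, hδ, fun x => ?_⟩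
  set X : ℝ := ∑ i, max (x i) 0 with hX
  have hX0 : ∀ i, max (x i) 0 ≤ X := fun i =>
    Finset.single_le_sum (f := fun i => max (x i) 0) (fun i _ => le_max_right _ _)
      (Finset.mem_univ i)
  have hXn : 0 ≤ X := Finset.sum_nonneg fun i _ => le_max_right _ _
  set a : Fin n → ℝ := fun i => max (-x i) 0 with ha
  set m : Fin r → ℝ := fun j =>
    (columnSupport A j).inf' (columnSupport_nonempty hA j) a with hm
  have hxa : ∀ i, x i = max (x i) 0 - a i := fun i => by
    rcases le_total 0 (x i) with h | h
    · simp [ha, h]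
    · simp [ha, h]
  have hlayer : δ * ‖a‖ ≤ ∑ i, σ i * a i - ∑ j, (k j : ℝ) * m j :=
    mul_norm_le_sum_sub_sum_inf' hA (fun I hI => by linarith [hδI I hI])
      (fun i => le_max_right _ _)
  have hnorm : ‖x‖ ≤ ‖a‖ + X := by
    refine (pi_norm_le_iff_of_nonneg (by positivity)).2 fun i => ?_
    have h1 : a i ≤ ‖a‖ := (le_abs_self _).trans (norm_le_pi_norm a i)
    have h2 := hX0 i
    have h3 : 0 ≤ a i := le_max_right _ _
    have h4 : 0 ≤ max (x i) 0 := le_max_right _ _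
    have h5 := hxa i
    rw [Real.norm_eq_abs, abs_le]
    constructor <;> linarith
  have hforms : c * ∑ i, Real.exp (x i) ≤ ∑ j, columnForm A j x := by
    unfold columnForm
    rw [Finset.sum_comm, Finset.mul_sum]
    refine Finset.sum_le_sum fun i _ => ?_
    rw [← Finset.sum_mul]
    exact mul_le_mul_of_nonneg_right (hcR i trivial) (Real.exp_pos _).le
  have hlin : ∑ i, σ i * x i ≤ (∑ i, |σ i|) * X - ∑ i, σ i * a i := by
    rw [Finset.sum_mul, ← Finset.sum_sub_distrib]
    refine Finset.sum_le_sum fun i _ => ?_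
    have h1 : σ i * max (x i) 0 ≤ |σ i| * X :=
      mul_le_mul (le_abs_self _) (hX0 i) (le_max_right _ _) (abs_nonneg _)
    have h2 : σ i * x i = σ i * max (x i) 0 - σ i * a i := by
      rw [← mul_sub, ← hxa i]
    linarith
  -- the exponential decay of the kernel beats every linear function of the positive parts
  have hdecay : N * X - c / 2 * ∑ i, Real.exp (x i) ≤ n * (N ^ 2 / c) := by
    have : ∀ i, N * max (x i) 0 - c / 2 * Real.exp (x i) ≤ N ^ 2 / c := fun i => by
      rcases le_total 0 (x i) with h | h
      · rw [max_eq_left h]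
        have h1 := Real.quadratic_le_exp_of_nonneg h
        have h2 : c / 2 * (x i ^ 2 / 2) ≤ c / 2 * Real.exp (x i) := by
          gcongr
          linarith
        rw [le_div_iff₀ hc]
        nlinarith [sq_nonneg (N - c * x i / 2), mul_le_mul_of_nonneg_left h2 hc.le]
      · rw [max_eq_right h]
        have := Real.exp_pos (x i)
        have : 0 ≤ N ^ 2 / c := by positivity
        nlinarith
    have hs := Finset.sum_le_sum fun i (_ : i ∈ Finset.univ) => this i
    rw [Finset.sum_sub_distrib, ← Finset.mul_sum, ← Finset.mul_sum] at hs
    simpa using hs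
  have hprod : ‖kernelProduct A k p x‖ ≤ ∏ j, (K j * L j) *
      Real.exp (|(k j : ℝ)| * X + k j * m j + -(1 / 2) * columnForm A j x) := by
    rw [kernelProduct, norm_prod]
    refine Finset.prod_le_prod (fun j _ => norm_nonneg _) fun j _ => ?_
    have hp := columnForm_pos hA j x
    rw [norm_mul, norm_zpow, Complex.norm_real, Real.norm_of_nonneg hp.le, Real.exp_add]
    calc _ ≤ (K j * Real.exp (|(k j : ℝ)| * X + k j * m j)) *
          (L j * Real.exp (-(1 / 2) * columnForm A j x)) :=
          mul_le_mul (hKx j x) (hLx j _ hp.le) (norm_nonneg _) (by have := hK j; positivity)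
      _ = _ := by ring
  rw [Finset.prod_mul_distrib, ← Real.exp_sum] at hprod
  have hKL : 0 ≤ ∏ j, K j * L j := Finset.prod_nonneg fun j _ => (mul_pos (hK j) (hL j)).le
  calc _ ≤ Real.exp (∑ i, σ i * x i) * ((∏ j, K j * L j) *
        Real.exp (∑ j, (|(k j : ℝ)| * X + k j * m j + -(1 / 2) * columnForm A j x))) := by gcongr
    _ = (∏ j, K j * L j) * Real.exp (∑ i, σ i * x i +
        ∑ j, (|(k j : ℝ)| * X + k j * m j + -(1 / 2) * columnForm A j x)) := by
      rw [Real.exp_add]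
      ring
    _ ≤ (∏ j, K j * L j) * Real.exp (n * (N ^ 2 / c) + -δ * ‖x‖) := by
      refine mul_le_mul_of_nonneg_left (Real.exp_le_exp.2 ?_) hKL
      rw [Finset.sum_add_distrib, Finset.sum_add_distrib, ← Finset.sum_mul, ← Finset.mul_sum]
      have h1 : N * X = (∑ j, |(k j : ℝ)|) * X + (∑ i, |σ i|) * X + δ * X := by rw [hN]; ring
      have h2 := mul_le_mul_of_nonneg_left hnorm hδ.le
      linarith
    _ = _ := by
      rw [Real.exp_add]
      ring

lemma continuous_kernelProduct (hA : A ∈ ShintaniMatrices n r) (k : Fin r → ℤ) (p : Fin r → ℕ) :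
    Continuous (kernelProduct A k p) := by
  unfold kernelProduct
  refine continuous_finsetProd _ fun j _ => Continuous.mul ?_ ?_
  · exact (Complex.continuous_ofReal.comp (continuous_columnForm j)).zpow₀ _ fun x =>
      Or.inl (Complex.ofReal_ne_zero.2 (columnForm_pos hA j x).ne')
  · exact (continuous_iff_continuousAt.2 fun y =>
      (hasDerivAt_iteratedDeriv_bernoulliKernel (p j) y).continuousAt).comp
        (continuous_columnForm j)

end Convergence

/-! ### Integrals of exponentials are analytic -/

section Analyticity

open MeasureTheory

/-- The `m`-th power of a functional, as a continuous multilinear map. -/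
noncomputable def powerMultilinear {V : Type*} [NormedAddCommGroup V] [NormedSpace ℂ V] (m : ℕ)
    (L : V →L[ℂ] ℂ) : ContinuousMultilinearMap ℂ (fun _ : Fin m => V) ℂ :=
  (ContinuousMultilinearMap.mkPiAlgebra ℂ (Fin m) ℂ).compContinuousLinearMap fun _ => L

variable {V : Type*} [NormedAddCommGroup V] [NormedSpace ℂ V]

lemma norm_powerMultilinear_le (m : ℕ) (L : V →L[ℂ] ℂ) : ‖powerMultilinear m L‖ ≤ ‖L‖ ^ m := by
  refine ContinuousMultilinearMap.opNorm_le_bound (by positivity) fun v => ?_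
  simp only [powerMultilinear, ContinuousMultilinearMap.compContinuousLinearMap_apply,
    ContinuousMultilinearMap.mkPiAlgebra_apply, norm_prod]
  calc ∏ i, ‖L (v i)‖ ≤ ∏ i, ‖L‖ * ‖v i‖ :=
        Finset.prod_le_prod (fun i _ => norm_nonneg _) fun i _ => L.le_opNorm _
    _ = _ := by simp [Finset.prod_mul_distrib]

lemma continuous_powerMultilinear (m : ℕ) :
    Continuous (powerMultilinear (V := V) m) := by
  have h := (ContinuousMultilinearMap.compContinuousLinearMapContinuousMultilinear ℂ
    (fun _ : Fin m => V) (fun _ : Fin m => ℂ) ℂ).cont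
  have h2 : Continuous fun L : V →L[ℂ] ℂ => (fun _ : Fin m => L) := by fun_prop
  exact (h.comp h2).clm_apply continuous_const

/-- An integral of exponentials of functionals is an analytic function of the argument, as soon as
it converges absolutely with some room; its power series is found by expanding the exponential. -/
theorem analyticAt_integral_exp_mul {X : Type*} [MeasurableSpace X] {μ : Measure X} {w : X → ℂ}
    {L : X → V →L[ℂ] ℂ} (hw : AEStronglyMeasurable w μ) (hL : AEStronglyMeasurable L μ) {ρ : ℝ}
    (hρ : 0 < ρ) (h : Integrable (fun x => Real.exp (ρ * ‖L x‖) * ‖w x‖) μ) :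
    AnalyticAt ℂ (fun s => ∫ x, Complex.exp (L x s) * w x ∂μ) 0 := by
  have hbound : ∀ (m : ℕ) x, ρ ^ m * ‖(w x / m.factorial) • powerMultilinear m (L x)‖ ≤
      Real.exp (ρ * ‖L x‖) * ‖w x‖ := fun m x => by
    rw [norm_smul, norm_div, Complex.norm_natCast]
    calc ρ ^ m * (‖w x‖ / m.factorial * ‖powerMultilinear m (L x)‖)
        ≤ ρ ^ m * (‖w x‖ / m.factorial * ‖L x‖ ^ m) := by
          gcongr
          exact norm_powerMultilinear_le m _
      _ = (ρ * ‖L x‖) ^ m / m.factorial * ‖w x‖ := by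
          rw [mul_pow]
          ring
      _ ≤ _ := by
          gcongr
          exact Real.pow_div_factorial_le_exp _ (by positivity) m
  have hmeas : ∀ m : ℕ, AEStronglyMeasurable
      (fun x => (w x / m.factorial) • powerMultilinear m (L x)) μ := fun m =>
    (show AEStronglyMeasurable (fun x => w x / (m.factorial : ℂ)) μ by
      simpa only [div_eq_mul_inv] using hw.mul_const (m.factorial : ℂ)⁻¹).smul
      ((continuous_powerMultilinear m).comp_aestronglyMeasurable hL)
  have hint : ∀ m : ℕ, Integrable
      (fun x => (w x / m.factorial) • powerMultilinear m (L x)) μ := fun m => by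
    refine (h.const_mul (ρ ^ m)⁻¹).mono' (hmeas m) (.of_forall fun x => ?_)
    rw [inv_mul_eq_div, le_div_iff₀' (by positivity)]
    exact hbound m x
  set p : FormalMultilinearSeries ℂ V ℂ := fun m =>
    ∫ x, (w x / m.factorial) • powerMultilinear m (L x) ∂μ with hp
  refine ⟨p, ENNReal.ofReal ρ, ?_, by simpa using hρ, fun {y} hy => ?_⟩
  · refine p.le_radius_of_bound (∫ x, Real.exp (ρ * ‖L x‖) * ‖w x‖ ∂μ) fun m => ?_
    rw [Real.coe_toNNReal _ hρ.le, mul_comm]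
    calc ρ ^ m * ‖p m‖ ≤ ρ ^ m * ∫ x, ‖(w x / m.factorial) • powerMultilinear m (L x)‖ ∂μ := by
          gcongr
          exact norm_integral_le_integral_norm _
      _ = ∫ x, ρ ^ m * ‖(w x / m.factorial) • powerMultilinear m (L x)‖ ∂μ :=
          (integral_const_mul _ _).symm
      _ ≤ _ := integral_mono ((hint m).norm.const_mul _) h (hbound m)
  · have hy' : ‖y‖ < ρ := by
      rw [Metric.mem_eball, edist_zero_right, ← ofReal_norm] at hy
      exact (ENNReal.ofReal_lt_ofReal_iff hρ).1 hy
    have happ : ∀ m : ℕ, p m (fun _ => y) =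
        ∫ x, (L x y) ^ m / m.factorial * w x ∂μ := fun m => by
      rw [hp]
      simp only
      rw [ContinuousMultilinearMap.integral_apply (hint m)]
      refine integral_congr_ae (.of_forall fun x => ?_)
      simp [powerMultilinear]
      ring
    simp only [happ, zero_add]
    refine hasSum_integral_of_dominated_convergence
      (fun m x => (ρ * ‖L x‖) ^ m / m.factorial * ‖w x‖) (fun m => ?_) (fun m => ?_) ?_ ?_ ?_
    · refine AEStronglyMeasurable.mul ?_ hw
      have : AEStronglyMeasurable (fun x => L x y) μ := hL.apply_continuousLinearMap y
      simpa only [div_eq_mul_inv] using! (this.pow m).mul_const (m.factorial : ℂ)⁻¹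
    · refine .of_forall fun x => ?_
      rw [norm_mul, norm_div, norm_pow, Complex.norm_natCast]
      gcongr
      calc ‖L x y‖ ≤ ‖L x‖ * ‖y‖ := (L x).le_opNorm y
        _ ≤ ρ * ‖L x‖ := by rw [mul_comm]; gcongr
    · exact .of_forall fun x => (Real.summable_pow_div_factorial _).mul_right _
    · refine h.congr (.of_forall fun x => ?_)
      simp only
      rw [tsum_mul_right, Real.exp_eq_exp_ℝ, NormedSpace.exp_eq_tsum_div]
    · refine .of_forall fun x => HasSum.mul_right _ ?_
      rw [Complex.exp_eq_exp_ℂ]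
      exact NormedSpace.expSeries_div_hasSum_exp _

end Analyticity

/-! ### Mellin integrals and integration by parts -/

/-- The Mellin integral `∫ ε ^ (s - 1) ∏_j ℓ_j ^ (-k_j) * H_j(ℓ_j) dε` over the positive orthant,
written in the coordinates `ε_i = exp x_i`. -/
noncomputable def mellinIntegral {n r : ℕ} (A : Matrix (Fin n) (Fin r) ℝ) (k : Fin r → ℤ)
    (p : Fin r → ℕ) (s : Fin n → ℂ) : ℂ :=
  ∫ x : Fin n → ℝ, Complex.exp (∑ i, s i * x i) * kernelProduct A k p x

section Mellin

open MeasureTheory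

variable {n r : ℕ} {A : Matrix (Fin n) (Fin r) ℝ}

lemma norm_exp_sum_mul (s : Fin n → ℂ) (x : Fin n → ℝ) :
    ‖Complex.exp (∑ i, s i * x i)‖ = Real.exp (∑ i, (s i).re * x i) := by
  rw [Complex.norm_exp]
  simp

lemma integrable_exp_mul_kernelProduct (hA : A ∈ ShintaniMatrices n r) {k : Fin r → ℤ}
    (p : Fin r → ℕ) {s : Fin n → ℂ} (h : ∀ I : Finset (Fin n), I.Nonempty →
      (supportWeight A k I : ℝ) < ∑ i ∈ I, (s i).re) :
    Integrable (fun x : Fin n → ℝ => Complex.exp (∑ i, s i * x i) * kernelProduct A k p x) := by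
  obtain ⟨K, δ, hδ, hK⟩ := exists_exp_mul_norm_kernelProduct_le hA p h
  refine ((integrable_exp_neg_mul_norm volume hδ).const_mul K).mono'
    (Continuous.aestronglyMeasurable ?_) (.of_forall fun x => ?_)
  · have := continuous_kernelProduct hA k p
    fun_prop
  · rw [norm_mul, norm_exp_sum_mul]
    exact hK x

/-- The functional `s ↦ ∑ s_i x_i` on `ℂⁿ`. -/
noncomputable def pairingFunctional (x : Fin n → ℝ) : (Fin n → ℂ) →L[ℂ] ℂ :=
  ∑ i, (x i : ℂ) • ContinuousLinearMap.proj i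

lemma pairingFunctional_apply (x : Fin n → ℝ) (s : Fin n → ℂ) :
    pairingFunctional x s = ∑ i, s i * x i := by
  simp [pairingFunctional, mul_comm]

lemma norm_pairingFunctional_le (x : Fin n → ℝ) : ‖pairingFunctional x‖ ≤ n * ‖x‖ := by
  refine ContinuousLinearMap.opNorm_le_bound _ (by positivity) fun s => ?_
  rw [pairingFunctional_apply]
  calc ‖∑ i, s i * x i‖ ≤ ∑ i : Fin n, ‖s‖ * ‖x‖ := norm_sum_le_of_le _ fun i _ => by
        rw [norm_mul, Complex.norm_real]
        exact mul_le_mul (norm_le_pi_norm s i) (norm_le_pi_norm x i) (norm_nonneg _)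
          (norm_nonneg _)
    _ = _ := by
        simp
        ring

theorem analyticAt_mellinIntegral (hA : A ∈ ShintaniMatrices n r) {k : Fin r → ℤ}
    (p : Fin r → ℕ) {s₀ : Fin n → ℂ} (h : ∀ I : Finset (Fin n), I.Nonempty →
      (supportWeight A k I : ℝ) < ∑ i ∈ I, (s₀ i).re) :
    AnalyticAt ℂ (mellinIntegral A k p) s₀ := by
  obtain ⟨K, δ, hδ, hK⟩ := exists_exp_mul_norm_kernelProduct_le hA p h
  have hcont := continuous_kernelProduct hA k p
  have hLc : Continuous (pairingFunctional (n := n)) := by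
    unfold pairingFunctional
    fun_prop
  have key := analyticAt_integral_exp_mul (μ := (volume : Measure (Fin n → ℝ)))
    (w := fun x => Complex.exp (∑ i, s₀ i * x i) * kernelProduct A k p x)
    (L := pairingFunctional) (ρ := δ / (2 * (n + 1)))
    (Continuous.aestronglyMeasurable (by fun_prop)) hLc.aestronglyMeasurable (by positivity) (by
      refine ((integrable_exp_neg_mul_norm volume (half_pos hδ)).const_mul K).mono'
        (Continuous.aestronglyMeasurable (by fun_prop)) (.of_forall fun x => ?_)
      rw [norm_mul, norm_norm, norm_mul, norm_exp_sum_mul,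
        Real.norm_of_nonneg (Real.exp_pos _).le]
      have h1 : δ / (2 * (n + 1)) * ‖pairingFunctional x‖ ≤ δ / 2 * ‖x‖ := by
        calc _ ≤ δ / (2 * (n + 1)) * (n * ‖x‖) := by
              gcongr
              exact norm_pairingFunctional_le x
          _ ≤ δ / (2 * (n + 1)) * ((n + 1) * ‖x‖) := by gcongr; linarith
          _ = _ := by field_simp
      calc _ ≤ Real.exp (δ / 2 * ‖x‖) * (K * Real.exp (-δ * ‖x‖)) := by
            refine mul_le_mul (Real.exp_le_exp.2 h1) (hK x) (by positivity) (by positivity)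
        _ = K * (Real.exp (δ / 2 * ‖x‖) * Real.exp (-δ * ‖x‖)) := by ring
        _ = _ := by
            rw [← Real.exp_add]
            ring_nf)
  have hcomp : mellinIntegral A k p = (fun s => ∫ x : Fin n → ℝ,
      Complex.exp (pairingFunctional x s) *
        (Complex.exp (∑ i, s₀ i * x i) * kernelProduct A k p x)) ∘ fun s => s - s₀ := by
    funext s
    refine integral_congr_ae (.of_forall fun x => ?_)
    simp only
    rw [← mul_assoc, ← Complex.exp_add, pairingFunctional_apply, ← Finset.sum_add_distrib]
    congr 2
    refine Finset.sum_congr rfl fun i _ => ?_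
    simp only [Pi.sub_apply]
    ring
  rw [hcomp]
  refine AnalyticAt.comp (by simpa using key) (by fun_prop)

lemma supportWeight_update (k : Fin r → ℤ) (j : Fin r) (a : ℤ) (I : Finset (Fin n)) :
    supportWeight A (Function.update k j a) I =
      supportWeight A k I + if columnSupport A j ⊆ I then a - k j else 0 := by
  classical
  unfold supportWeight
  rw [Finset.sum_filter, Finset.sum_filter, ← Finset.add_sum_erase _ _ (Finset.mem_univ j),
    ← Finset.add_sum_erase _ (fun j => if columnSupport A j ⊆ I then k j else 0)
      (Finset.mem_univ j)]
  have : ∀ j' ∈ Finset.univ.erase j, (if columnSupport A j' ⊆ I then Function.update k j a j'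
      else 0) = if columnSupport A j' ⊆ I then k j' else 0 := fun j' hj' => by
    rw [Function.update_of_ne (Finset.ne_of_mem_erase hj')]
  rw [Finset.sum_congr rfl this, Function.update_self]
  split_ifs <;> ring

lemma kernelProduct_update (k : Fin r → ℤ) (p : Fin r → ℕ) (j : Fin r) (a : ℤ) (b : ℕ)
    (x : Fin n → ℝ) :
    kernelProduct A (Function.update k j a) (Function.update p j b) x =
      (∏ j' ∈ Finset.univ.erase j, (columnForm A j' x : ℂ) ^ (-k j') *
        iteratedDeriv (p j') bernoulliKernel (columnForm A j' x)) *
      ((columnForm A j x : ℂ) ^ (-a) * iteratedDeriv b bernoulliKernel (columnForm A j x)) := by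
  classical
  rw [kernelProduct, ← Finset.prod_erase_mul _ _ (Finset.mem_univ j)]
  congr 1
  · exact Finset.prod_congr rfl fun j' hj' => by
      rw [Function.update_of_ne (Finset.ne_of_mem_erase hj'),
        Function.update_of_ne (Finset.ne_of_mem_erase hj')]
  · simp

/-- The terms that arise from the `j`-th factor when the kernel is differentiated in the direction
of the indicator of `I`. -/
noncomputable def derivTerm (A : Matrix (Fin n) (Fin r) ℝ) (k : Fin r → ℤ) (p : Fin r → ℕ)
    (I : Finset (Fin n)) (j : Fin r) (x : Fin n → ℝ) : ℂ :=
  if columnSupport A j ⊆ I then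
    -(k j : ℂ) * kernelProduct A k p x +
      kernelProduct A (Function.update k j (k j - 1)) (Function.update p j (p j + 1)) x
  else ∑ i ∈ I ∩ columnSupport A j, (A i j : ℂ) * (Real.exp (x i) : ℂ) *
    (-(k j : ℂ) * kernelProduct A (Function.update k j (k j + 1)) p x +
      kernelProduct A k (Function.update p j (p j + 1)) x)

lemma hasLineDerivAt_kernelProduct (hA : A ∈ ShintaniMatrices n r) (k : Fin r → ℤ)
    (p : Fin r → ℕ) (I : Finset (Fin n)) (x : Fin n → ℝ) :
    HasLineDerivAt ℝ (kernelProduct A k p) (∑ j, derivTerm A k p I j x) x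
      (fun i => if i ∈ I then 1 else 0) := by
  classical
  have hform : ∀ j, HasDerivAt
      (fun t : ℝ => columnForm A j (x + t • fun i => if i ∈ I then (1 : ℝ) else 0))
      (∑ i ∈ I, A i j * Real.exp (x i)) 0 := fun j => by
    have h : ∀ i ∈ Finset.univ, HasDerivAt (fun t : ℝ =>
        A i j * Real.exp (x i + t * if i ∈ I then (1 : ℝ) else 0))
        (if i ∈ I then A i j * Real.exp (x i) else 0) 0 := fun i _ => by
      have h1 : HasDerivAt (fun t : ℝ => x i + t * if i ∈ I then (1 : ℝ) else 0)
          (if i ∈ I then (1 : ℝ) else 0) 0 := by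
        simpa using ((hasDerivAt_id (0 : ℝ)).mul_const (if i ∈ I then (1 : ℝ) else 0)).const_add
          (x i)
      have h2 := (h1.exp).const_mul (A i j)
      exact h2.congr_deriv (by split_ifs <;> simp)
    have := HasDerivAt.fun_sum h
    rw [Finset.sum_ite_mem, Finset.univ_inter] at this
    exact this
  have hfac : ∀ j, HasDerivAt (fun t : ℝ =>
      (fun y : ℝ => (y : ℂ) ^ (-k j) * iteratedDeriv (p j) bernoulliKernel y)
        (columnForm A j (x + t • fun i => if i ∈ I then (1 : ℝ) else 0)))
      ((∑ i ∈ I, A i j * Real.exp (x i)) •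
        ((-(k j : ℂ)) * (columnForm A j x : ℂ) ^ (-(k j + 1)) *
          iteratedDeriv (p j) bernoulliKernel (columnForm A j x) +
        (columnForm A j x : ℂ) ^ (-k j) *
          iteratedDeriv (p j + 1) bernoulliKernel (columnForm A j x))) 0 := fun j => by
    have h0 : (columnForm A j x : ℂ) ≠ 0 :=
      Complex.ofReal_ne_zero.2 (columnForm_pos hA j x).ne'
    have h1 := (hasDerivAt_zpow (-k j) (columnForm A j x : ℂ) (Or.inl h0)).comp_ofReal
    have h2 := h1.mul (hasDerivAt_iteratedDeriv_bernoulliKernel (p j) (columnForm A j x))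
    have h3 : columnForm A j (x + (0 : ℝ) • fun i => if i ∈ I then (1 : ℝ) else 0) =
      columnForm A j x := by simp
    rw [← h3] at h2
    have h4 := HasDerivAt.scomp (0 : ℝ) h2 (hform j)
    rw [h3] at h4
    refine h4.congr_deriv ?_
    push_cast
    rw [show -k j - 1 = -(k j + 1) by ring]
  have hprod := HasDerivAt.fun_finsetProd (u := Finset.univ) (fun j _ => hfac j)
  rw [HasLineDerivAt]
  refine hprod.congr_deriv (Finset.sum_congr rfl fun j _ => ?_)
  have h0 : (columnForm A j x : ℂ) ≠ 0 :=
    Complex.ofReal_ne_zero.2 (columnForm_pos hA j x).ne'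
  have hk := kernelProduct_update (A := A) k p j (k j) (p j) x
  have hk1 := kernelProduct_update (A := A) k p j (k j - 1) (p j + 1) x
  have hk2 := kernelProduct_update (A := A) k p j (k j + 1) (p j) x
  have hk3 := kernelProduct_update (A := A) k p j (k j) (p j + 1) x
  rw [Function.update_eq_self] at hk hk3
  rw [Function.update_eq_self] at hk hk2
  simp only [zero_smul, add_zero, smul_eq_mul, Complex.real_smul]
  unfold derivTerm
  split_ifs with hj
  · have hsum : ∑ i ∈ I, A i j * Real.exp (x i) = columnForm A j x :=
      Finset.sum_subset (Finset.subset_univ I) fun i _ hi => by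
        rw [eq_zero_of_notMem_columnSupport hA fun h => hi (hj h), zero_mul]
    rw [hsum, hk, hk1]
    have e1 : (columnForm A j x : ℂ) * (columnForm A j x : ℂ) ^ (-(k j + 1)) =
        (columnForm A j x : ℂ) ^ (-k j) := by
      rw [← zpow_one_add₀ h0]
      ring_nf
    have e2 : (columnForm A j x : ℂ) * (columnForm A j x : ℂ) ^ (-k j) =
        (columnForm A j x : ℂ) ^ (-(k j - 1)) := by
      rw [← zpow_one_add₀ h0]
      ring_nf
    rw [← e1, ← e2, ← e1]
    ring
  · have hsum : ∑ i ∈ I, A i j * Real.exp (x i) =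
        ∑ i ∈ I ∩ columnSupport A j, A i j * Real.exp (x i) :=
      (Finset.sum_subset Finset.inter_subset_left fun i hi hi' => by
        rw [eq_zero_of_notMem_columnSupport hA fun h => hi' (Finset.mem_inter.2 ⟨hi, h⟩),
          zero_mul]).symm
    rw [hsum, hk2, hk3]
    push_cast
    rw [← Finset.sum_mul]
    ring

end Mellin

section ByParts

open MeasureTheory

variable {n r : ℕ} {A : Matrix (Fin n) (Fin r) ℝ}

lemma exp_sum_mul_mul_exp (s : Fin n → ℂ) (x : Fin n → ℝ) (i : Fin n) :
    Complex.exp (∑ i, s i * x i) * (Real.exp (x i) : ℂ) =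
      Complex.exp (∑ i', (s + Pi.single i 1 : Fin n → ℂ) i' * x i') := by
  rw [Complex.ofReal_exp, ← Complex.exp_add]
  congr 1
  simp [add_mul, Finset.sum_add_distrib, Pi.single_apply]

lemma sum_re_add_single (s : Fin n → ℂ) (i : Fin n) (I : Finset (Fin n)) :
    ∑ i' ∈ I, ((s + Pi.single i 1 : Fin n → ℂ) i').re = ∑ i' ∈ I, (s i').re + if i ∈ I then 1 else 0 := by
  have : ∀ i', ((s + Pi.single i 1 : Fin n → ℂ) i').re = (s i').re + if i = i' then 1 else 0 := fun i' => by
    by_cases h : i = i'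
    · subst h; simp
    · simp [h, Ne.symm h]
  simp only [this, Finset.sum_add_distrib]
  simp

/-- The contribution of the `j`-th factor to the integration by parts in the direction `I`. -/
noncomputable def derivIntegral (A : Matrix (Fin n) (Fin r) ℝ) (k : Fin r → ℤ) (p : Fin r → ℕ)
    (I : Finset (Fin n)) (j : Fin r) (s : Fin n → ℂ) : ℂ :=
  if columnSupport A j ⊆ I then
    mellinIntegral A (Function.update k j (k j - 1)) (Function.update p j (p j + 1)) s
  else ∑ i ∈ I ∩ columnSupport A j, (A i j : ℂ) *
    (-(k j : ℂ) * mellinIntegral A (Function.update k j (k j + 1)) p (s + Pi.single i 1) +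
      mellinIntegral A k (Function.update p j (p j + 1)) (s + Pi.single i 1))

/-- Lowering the exponent of a column form keeps the integral convergent. -/
lemma supportWeight_update_sub_one_le (k : Fin r → ℤ) (j : Fin r) (I : Finset (Fin n)) :
    supportWeight A (Function.update k j (k j - 1)) I ≤ supportWeight A k I := by
  rw [supportWeight_update]
  split_ifs <;> linarith

/-- Raising the exponent of the `j`-th column form by one is compensated by a factor `ε_i` with
`i` in the support of this form. -/
lemma supportWeight_update_add_one_le (k : Fin r → ℤ) {i : Fin n} {j : Fin r}
    (hi : i ∈ columnSupport A j) (I : Finset (Fin n)) :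
    supportWeight A (Function.update k j (k j + 1)) I ≤
      supportWeight A k I + if i ∈ I then 1 else 0 := by
  rw [supportWeight_update]
  by_cases h : columnSupport A j ⊆ I
  · simp [h, h hi]
  · simp only [h, if_false]
    split_ifs <;> linarith

lemma integrable_and_integral_derivTerm (hA : A ∈ ShintaniMatrices n r) {k : Fin r → ℤ}
    (p : Fin r → ℕ) {s : Fin n → ℂ} (h : ∀ I : Finset (Fin n), I.Nonempty →
      (supportWeight A k I : ℝ) < ∑ i ∈ I, (s i).re) (I : Finset (Fin n)) (j : Fin r) :
    Integrable (fun x : Fin n → ℝ => Complex.exp (∑ i, s i * x i) * derivTerm A k p I j x) ∧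
    ∫ x : Fin n → ℝ, Complex.exp (∑ i, s i * x i) * derivTerm A k p I j x =
      (if columnSupport A j ⊆ I then -(k j : ℂ) else 0) * mellinIntegral A k p s +
        derivIntegral A k p I j s := by
  have h0 := integrable_exp_mul_kernelProduct hA p h
  unfold derivTerm derivIntegral
  split_ifs with hj
  · have h1 := integrable_exp_mul_kernelProduct hA (k := Function.update k j (k j - 1))
      (Function.update p j (p j + 1)) (s := s) fun I' hI' =>
        lt_of_le_of_lt (by exact_mod_cast supportWeight_update_sub_one_le k j I') (h I' hI')
    have e : (fun x : Fin n → ℝ => Complex.exp (∑ i, s i * x i) * (-(k j : ℂ) *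
        kernelProduct A k p x +
          kernelProduct A (Function.update k j (k j - 1)) (Function.update p j (p j + 1)) x)) =
        fun x => -(k j : ℂ) * (Complex.exp (∑ i, s i * x i) * kernelProduct A k p x) +
          Complex.exp (∑ i, s i * x i) *
          kernelProduct A (Function.update k j (k j - 1)) (Function.update p j (p j + 1)) x := by
      funext x
      ring
    rw [e]
    refine ⟨(h0.const_mul _).add h1, ?_⟩
    rw [integral_add (h0.const_mul _) h1, integral_const_mul]
    rfl
  · have h1 : ∀ i ∈ I ∩ columnSupport A j, Integrable fun x : Fin n → ℝ =>
        Complex.exp (∑ i', (s + Pi.single i 1 : Fin n → ℂ) i' * x i') *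
          kernelProduct A (Function.update k j (k j + 1)) p x := fun i hi =>
      integrable_exp_mul_kernelProduct hA _ fun I' hI' => by
        have h2 := supportWeight_update_add_one_le k (Finset.mem_inter.1 hi).2 I'
        have h3 := h I' hI'
        rw [sum_re_add_single]
        have h4 : (supportWeight A (Function.update k j (k j + 1)) I' : ℝ) ≤
            supportWeight A k I' + if i ∈ I' then 1 else 0 := by exact_mod_cast h2
        linarith
    have h2 : ∀ i, Integrable fun x : Fin n → ℝ =>
        Complex.exp (∑ i', (s + Pi.single i 1 : Fin n → ℂ) i' * x i') *
          kernelProduct A k (Function.update p j (p j + 1)) x := fun i =>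
      integrable_exp_mul_kernelProduct hA _ fun I' hI' => by
        have h3 := h I' hI'
        rw [sum_re_add_single]
        have : (0 : ℝ) ≤ if i ∈ I' then 1 else 0 := by split_ifs <;> norm_num
        linarith
    have e : (fun x : Fin n → ℝ => Complex.exp (∑ i, s i * x i) *
        ∑ i ∈ I ∩ columnSupport A j, (A i j : ℂ) * (Real.exp (x i) : ℂ) *
          (-(k j : ℂ) * kernelProduct A (Function.update k j (k j + 1)) p x +
          kernelProduct A k (Function.update p j (p j + 1)) x)) =
        fun x => ∑ i ∈ I ∩ columnSupport A j, (A i j : ℂ) *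
          (-(k j : ℂ) * (Complex.exp (∑ i', (s + Pi.single i 1 : Fin n → ℂ) i' * x i') *
            kernelProduct A (Function.update k j (k j + 1)) p x) +
          Complex.exp (∑ i', (s + Pi.single i 1 : Fin n → ℂ) i' * x i') *
            kernelProduct A k (Function.update p j (p j + 1)) x) := by
      funext x
      rw [Finset.mul_sum]
      refine Finset.sum_congr rfl fun i _ => ?_
      rw [← exp_sum_mul_mul_exp]
      ring
    rw [e]
    have h3 : ∀ i ∈ I ∩ columnSupport A j, Integrable fun x : Fin n → ℝ => (A i j : ℂ) *
          (-(k j : ℂ) * (Complex.exp (∑ i', (s + Pi.single i 1 : Fin n → ℂ) i' * x i') *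
            kernelProduct A (Function.update k j (k j + 1)) p x) +
          Complex.exp (∑ i', (s + Pi.single i 1 : Fin n → ℂ) i' * x i') *
            kernelProduct A k (Function.update p j (p j + 1)) x) := fun i hi =>
      (((h1 i hi).const_mul _).add (h2 i)).const_mul _
    refine ⟨integrable_finsetSum _ h3, ?_⟩
    rw [integral_finsetSum _ h3, zero_mul, zero_add]
    refine Finset.sum_congr rfl fun i hi => ?_
    rw [integral_const_mul, integral_add ((h1 i hi).const_mul _) (h2 i), integral_const_mul]
    rfl

/-- Integration by parts in the direction of the indicator of `I`, that is, scaling of the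
variables `ε_i`, `i ∈ I`: it relates the integral, multiplied by the affine form
`∑_{i ∈ I} s_i - (weight of I)`, to integrals that converge farther to the left. -/
theorem mellinIntegral_by_parts (hA : A ∈ ShintaniMatrices n r) {k : Fin r → ℤ}
    (p : Fin r → ℕ) {s : Fin n → ℂ} (h : ∀ I : Finset (Fin n), I.Nonempty →
      (supportWeight A k I : ℝ) < ∑ i ∈ I, (s i).re) (I : Finset (Fin n)) :
    (∑ i ∈ I, s i - supportWeight A k I) * mellinIntegral A k p s =
      -∑ j, derivIntegral A k p I j s := by
  have h0 := integrable_exp_mul_kernelProduct hA p h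
  have hd := integrable_and_integral_derivTerm hA p h I
  have hsum : (fun x : Fin n → ℝ => Complex.exp (∑ i, s i * x i) * ∑ j, derivTerm A k p I j x) =
      fun x => ∑ j, Complex.exp (∑ i, s i * x i) * derivTerm A k p I j x := by
    funext x
    rw [Finset.mul_sum]
  have hint : Integrable fun x : Fin n → ℝ =>
      Complex.exp (∑ i, s i * x i) * ∑ j, derivTerm A k p I j x := by
    rw [hsum]
    exact integrable_finsetSum _ fun j _ => (hd j).1
  have hexp : ∀ x : Fin n → ℝ, HasLineDerivAt ℝ
      (fun x : Fin n → ℝ => Complex.exp (∑ i, s i * x i))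
      ((∑ i ∈ I, s i) * Complex.exp (∑ i, s i * x i)) x
      (fun i => if i ∈ I then (1 : ℝ) else 0) := fun x => by
    have h1 : ∀ i ∈ Finset.univ, HasDerivAt
        (fun t : ℝ => s i * ((x + t • fun i => if i ∈ I then (1 : ℝ) else 0) i : ℝ))
        (if i ∈ I then s i else 0) 0 := fun i _ => by
      have h2 : HasDerivAt (fun t : ℝ => x i + t * if i ∈ I then (1 : ℝ) else 0)
          (if i ∈ I then (1 : ℝ) else 0) 0 := by
        simpa using ((hasDerivAt_id (0 : ℝ)).mul_const (if i ∈ I then (1 : ℝ) else 0)).const_add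
          (x i)
      exact (h2.ofReal_comp.const_mul (s i)).congr_deriv (by split_ifs <;> simp)
    have h3 := (HasDerivAt.fun_sum h1).cexp
    rw [Finset.sum_ite_mem, Finset.univ_inter] at h3
    exact h3.congr_deriv (by simp [mul_comm])
  have hparts := integral_bilinear_hasLineDerivAt_right_eq_neg_left_of_integrable
    (μ := (volume : Measure (Fin n → ℝ))) (B := ContinuousLinearMap.mul ℝ ℂ)
    (f := fun x : Fin n → ℝ => Complex.exp (∑ i, s i * x i))
    (f' := fun x => (∑ i ∈ I, s i) * Complex.exp (∑ i, s i * x i))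
    (g := kernelProduct A k p) (g' := fun x => ∑ j, derivTerm A k p I j x)
    (v := fun i => if i ∈ I then (1 : ℝ) else 0)
    (by simpa [mul_assoc] using h0.const_mul (∑ i ∈ I, s i))
    (by simpa only [ContinuousLinearMap.mul_apply'] using hint)
    (by simpa using h0) (fun x _ => hexp x) (fun x _ => hasLineDerivAt_kernelProduct hA k p I x)
  simp only [ContinuousLinearMap.mul_apply'] at hparts
  rw [hsum, integral_finsetSum _ fun j _ => (hd j).1,
    Finset.sum_congr rfl fun j _ => (hd j).2, Finset.sum_add_distrib, ← Finset.sum_mul] at hparts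
  have hw : ∑ j, (if columnSupport A j ⊆ I then -(k j : ℂ) else 0) = -(supportWeight A k I : ℂ) := by
    rw [supportWeight, Finset.sum_filter]
    push_cast
    rw [← Finset.sum_neg_distrib]
    exact Finset.sum_congr rfl fun j _ => by split_ifs <;> simp
  have hJ : ∫ x : Fin n → ℝ, (∑ i ∈ I, s i) * Complex.exp (∑ i, s i * x i) * kernelProduct A k p x =
      (∑ i ∈ I, s i) * mellinIntegral A k p s := by
    rw [mellinIntegral, ← integral_const_mul]
    simp only [mul_assoc]
  rw [hw, hJ] at hparts
  linear_combination hparts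

end ByParts

/-! ### Continuation of the Mellin integrals -/

section Continuation

variable {n r : ℕ} {A : Matrix (Fin n) (Fin r) ℝ}

/-- The region `∑_{i ∈ I} Re s_i > d_I` for all connected sets `I`. -/
def connectedRegion (A : Matrix (Fin n) (Fin r) ℝ) (d : Finset (Fin n) → ℤ) : Set (Fin n → ℂ) :=
  {s | ∀ I, IsConnectedSet A I → (d I : ℝ) < ∑ i ∈ I, (s i).re}

open Classical in
/-- The product of the affine forms `∑_{i ∈ I} s_i - c` for `I` connected and `d₀ I < c ≤ d I`. -/
noncomputable def polarProduct (A : Matrix (Fin n) (Fin r) ℝ) (d₀ d : Finset (Fin n) → ℤ)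
    (s : Fin n → ℂ) : ℂ :=
  ∏ I with IsConnectedSet A I, ∏ c ∈ Finset.Ioc (d₀ I) (d I), (∑ i ∈ I, s i - (c : ℂ))

/-- After multiplication with the affine forms between `d₀` and `d`, the function `T` on the region
of `d` extends analytically to the region of `d₀`. -/
def HasContinuation (A : Matrix (Fin n) (Fin r) ℝ) (d₀ d : Finset (Fin n) → ℤ)
    (T : (Fin n → ℂ) → ℂ) : Prop :=
  ∃ E : (Fin n → ℂ) → ℂ, AnalyticOnNhd ℂ E (connectedRegion A d₀) ∧
    ∀ s ∈ connectedRegion A d, E s = polarProduct A d₀ d s * T s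

lemma HasContinuation.const_mul {d₀ d : Finset (Fin n) → ℤ} {T : (Fin n → ℂ) → ℂ}
    (h : HasContinuation A d₀ d T) (a : ℂ) : HasContinuation A d₀ d fun s => a * T s := by
  obtain ⟨E, hE, he⟩ := h
  refine ⟨fun s => a * E s, fun s hs => analyticAt_const.mul (hE s hs), fun s hs => ?_⟩
  simp only [he s hs]
  ring

lemma HasContinuation.add {d₀ d : Finset (Fin n) → ℤ} {T T' : (Fin n → ℂ) → ℂ}
    (h : HasContinuation A d₀ d T) (h' : HasContinuation A d₀ d T') :
    HasContinuation A d₀ d fun s => T s + T' s := by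
  obtain ⟨E, hE, he⟩ := h
  obtain ⟨E', hE', he'⟩ := h'
  refine ⟨fun s => E s + E' s, fun s hs => (hE s hs).add (hE' s hs), fun s hs => ?_⟩
  simp only [he s hs, he' s hs]
  ring

lemma HasContinuation.sum {ι : Type*} (S : Finset ι) {d₀ d : Finset (Fin n) → ℤ}
    {T : ι → (Fin n → ℂ) → ℂ} (h : ∀ i ∈ S, HasContinuation A d₀ d (T i)) :
    HasContinuation A d₀ d fun s => ∑ i ∈ S, T i s := by
  classical
  induction S using Finset.induction_on with
  | empty => exact ⟨fun _ => 0, fun s _ => analyticAt_const, by simp⟩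
  | insert i S hi ih =>
    simp only [Finset.sum_insert hi]
    exact (h i (Finset.mem_insert_self i S)).add
      (ih fun i' hi' => h i' (Finset.mem_insert_of_mem hi'))

lemma connectedRegion_anti {d d' : Finset (Fin n) → ℤ}
    (h : ∀ I, IsConnectedSet A I → d' I ≤ d I) :
    connectedRegion A d ⊆ connectedRegion A d' := fun _ hs I hI =>
  lt_of_le_of_lt (by exact_mod_cast h I hI) (hs I hI)

lemma polarProduct_eq_mul_update {d₀ d : Finset (Fin n) → ℤ} {I : Finset (Fin n)}
    (hI : IsConnectedSet A I) (h : d₀ I < d I) (s : Fin n → ℂ) :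
    polarProduct A d₀ d s = polarProduct A d₀ (Function.update d I (d I - 1)) s *
      (∑ i ∈ I, s i - (d I : ℂ)) := by
  classical
  have hmem : I ∈ Finset.univ.filter (IsConnectedSet A) := by simp [hI]
  unfold polarProduct
  rw [← Finset.prod_erase_mul _ _ hmem, ← Finset.prod_erase_mul (Finset.univ.filter
    (IsConnectedSet A)) (fun I' => ∏ c ∈ Finset.Ioc (d₀ I') (Function.update d I (d I - 1) I'),
      (∑ i ∈ I', s i - (c : ℂ))) hmem, mul_assoc]
  congr 1
  · exact Finset.prod_congr rfl fun I' hI' => by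
      rw [Function.update_of_ne (Finset.ne_of_mem_erase hI')]
  · rw [Function.update_self]
    have : Finset.Ioc (d₀ I) (d I) = insert (d I) (Finset.Ioc (d₀ I) (d I - 1)) := by
      ext c
      simp only [Finset.mem_Ioc, Finset.mem_insert]
      omega
    rw [this, Finset.prod_insert (by simp), mul_comm]

lemma HasContinuation.of_update {d₀ d : Finset (Fin n) → ℤ} {T R : (Fin n → ℂ) → ℂ}
    {I : Finset (Fin n)} (hI : IsConnectedSet A I) (h : d₀ I < d I)
    (hR : HasContinuation A d₀ (Function.update d I (d I - 1)) R)
    (hTR : ∀ s ∈ connectedRegion A d, (∑ i ∈ I, s i - (d I : ℂ)) * T s = R s) :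
    HasContinuation A d₀ d T := by
  obtain ⟨E, hE, he⟩ := hR
  refine ⟨E, hE, fun s hs => ?_⟩
  have hsub : connectedRegion A d ⊆ connectedRegion A (Function.update d I (d I - 1)) :=
    connectedRegion_anti fun I' _ => by
      by_cases h' : I' = I
      · subst h'; simp
      · simp [h']
  rw [he s (hsub hs), polarProduct_eq_mul_update hI h, mul_assoc, hTR s hs]

lemma analyticAt_sum_sub_const (I : Finset (Fin n)) (c : ℂ) (s₀ : Fin n → ℂ) :
    AnalyticAt ℂ (fun s : Fin n → ℂ => ∑ i ∈ I, s i - c) s₀ := by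
  refine AnalyticAt.sub (Finset.analyticAt_fun_sum _ fun i _ => ?_) analyticAt_const
  exact (ContinuousLinearMap.proj (R := ℂ) (φ := fun _ : Fin n => ℂ) i).analyticAt s₀

lemma HasContinuation.of_update_self {d₀ d : Finset (Fin n) → ℤ} {T : (Fin n → ℂ) → ℂ}
    {I : Finset (Fin n)} (hI : IsConnectedSet A I) (h : d₀ I < d I)
    (hT : HasContinuation A d₀ (Function.update d I (d I - 1)) T) :
    HasContinuation A d₀ d T := by
  obtain ⟨E, hE, he⟩ := hT
  refine HasContinuation.of_update hI h (R := fun s => (∑ i ∈ I, s i - (d I : ℂ)) * T s)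
    ⟨fun s => (∑ i ∈ I, s i - (d I : ℂ)) * E s,
      fun s hs => (analyticAt_sum_sub_const I _ s).mul (hE s hs), fun s hs => ?_⟩ fun s _ => rfl
  simp only [he s hs]
  ring

/-- All the Mellin integrals have analytic continuations after multiplication with affine forms,
each to the first power. The induction lowers one of the bounds `d I` by one, using integration by
parts in the direction `I` if the integral does not converge beyond `d I` already. -/
theorem hasContinuation_mellinIntegral (hA : A ∈ ShintaniMatrices n r)
    (d₀ d : Finset (Fin n) → ℤ) (k : Fin r → ℤ) (p : Fin r → ℕ) (β : Fin n → ℕ)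
    (hd : ∀ I, IsConnectedSet A I → supportWeight A k I - ∑ i ∈ I, (β i : ℤ) ≤ d I) :
    HasContinuation A d₀ d fun s => mellinIntegral A k p (s + fun i => (β i : ℂ)) := by
  classical
  obtain ⟨N, hN⟩ : ∃ N, ∑ I with IsConnectedSet A I, (d I - d₀ I).toNat = N := ⟨_, rfl⟩
  have hconv : ∀ (d : Finset (Fin n) → ℤ) (k : Fin r → ℤ) (β : Fin n → ℕ),
      (∀ I, IsConnectedSet A I → supportWeight A k I - ∑ i ∈ I, (β i : ℤ) ≤ d I) →
      ∀ s ∈ connectedRegion A d, ∀ I : Finset (Fin n), I.Nonempty →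
      (supportWeight A k I : ℝ) < ∑ i ∈ I, ((s + fun i => (β i : ℂ) : Fin n → ℂ) i).re := by
    intro d k β hd s hs
    refine supportWeight_lt_sum_of_isConnectedSet hA fun I hI => ?_
    have h1 := hs I hI
    have h2 : (supportWeight A k I : ℝ) - ∑ i ∈ I, (β i : ℝ) ≤ d I := by exact_mod_cast hd I hI
    simp only [Pi.add_apply, Complex.add_re, Complex.natCast_re, Finset.sum_add_distrib]
    linarith
  induction N generalizing d k p β with
  | zero =>
    have hle : ∀ I, IsConnectedSet A I → d I ≤ d₀ I := fun I hI => by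
      have := (Finset.sum_eq_zero_iff.1 hN) I (by simp [hI])
      omega
    refine ⟨fun s => mellinIntegral A k p (s + fun i => (β i : ℂ)), fun s hs => ?_,
      fun s hs => ?_⟩
    · have := analyticAt_mellinIntegral hA p (hconv d k β hd s (connectedRegion_anti hle hs))
      exact this.comp (f := fun s : Fin n → ℂ => s + fun i => (β i : ℂ))
        (analyticAt_id.add analyticAt_const)
    · have : polarProduct A d₀ d s = 1 := Finset.prod_eq_one fun I hI => by
        rw [Finset.Ioc_eq_empty (not_lt.2 (hle I (Finset.mem_filter.1 hI).2)), Finset.prod_empty]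
      simp only [this, one_mul]
  | succ N ih =>
    obtain ⟨I, hI, hlt⟩ : ∃ I, IsConnectedSet A I ∧ d₀ I < d I := by
      by_contra! hcon
      rw [Finset.sum_eq_zero fun I hI => by
        have := hcon I (Finset.mem_filter.1 hI).2
        omega] at hN
      omega
    have hmem : I ∈ Finset.univ.filter (IsConnectedSet A) := by simp [hI]
    have hN' : ∑ I' with IsConnectedSet A I',
        (Function.update d I (d I - 1) I' - d₀ I').toNat = N := by
      rw [← Finset.add_sum_erase _ _ hmem] at hN ⊢
      rw [Finset.sum_congr rfl fun I' hI' => by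
        rw [Function.update_of_ne (Finset.ne_of_mem_erase hI')], Function.update_self]
      omega
    -- bounds below `d` that are smaller by one at `I` are bounds below the updated `d`
    have hupd : ∀ g : Finset (Fin n) → ℤ, (∀ I', IsConnectedSet A I' → g I' ≤ d I') →
        g I ≤ d I - 1 → ∀ I', IsConnectedSet A I' → g I' ≤ Function.update d I (d I - 1) I' :=
      fun g hg hgI I' hI' => by
        by_cases h : I' = I
        · subst h
          simpa using hgI
        · simpa [h] using hg I' hI'
    by_cases hle : supportWeight A k I - ∑ i ∈ I, (β i : ℤ) ≤ d I - 1
    · exact HasContinuation.of_update_self hI hlt (ih _ k p β (hupd _ hd hle) hN')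
    · have heq : supportWeight A k I - ∑ i ∈ I, (β i : ℤ) = d I :=
        le_antisymm (hd I hI) (by omega)
      refine HasContinuation.of_update hI hlt
        (R := fun s => ∑ j, (-1) * derivIntegral A k p I j (s + fun i => (β i : ℂ))) ?_ ?_
      · refine HasContinuation.sum _ fun j _ => HasContinuation.const_mul ?_ _
        unfold derivIntegral
        split_ifs with hj
        · refine ih _ _ _ _ (hupd _ (fun I' hI' => ?_) ?_) hN'
          · have h1 := supportWeight_update_sub_one_le (A := A) k j I'
            have h2 := hd I' hI'
            omega
          · rw [supportWeight_update, if_pos hj]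
            omega
        · refine HasContinuation.sum _ fun i hi => HasContinuation.const_mul ?_ _
          obtain ⟨hiI, hij⟩ := Finset.mem_inter.1 hi
          have hshift : ∀ s : Fin n → ℂ, (s + fun i => (β i : ℂ)) + Pi.single i 1 =
              s + fun i' => (((β + Pi.single i 1 : Fin n → ℕ) i' : ℕ) : ℂ) := fun s => by
            funext i'
            by_cases h : i' = i
            · subst h
              simp [add_assoc]
            · simp [h]
          have hsum : ∀ I' : Finset (Fin n), ∑ i' ∈ I', (((β + Pi.single i 1 : Fin n → ℕ) i' : ℕ) : ℤ) =
              ∑ i' ∈ I', (β i' : ℤ) + if i ∈ I' then 1 else 0 := fun I' => by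
            simp [Finset.sum_add_distrib, Pi.single_apply]
          simp only [hshift]
          refine HasContinuation.add (HasContinuation.const_mul
            (ih _ _ _ _ (hupd _ (fun I' hI' => ?_) ?_) hN') _)
            (ih _ _ _ _ (hupd _ (fun I' hI' => ?_) ?_) hN')
          · have h1 := supportWeight_update_add_one_le k hij I'
            have h2 := hd I' hI'
            rw [hsum]
            omega
          · rw [hsum, supportWeight_update, if_neg hj, if_pos hiI]
            omega
          · have h2 := hd I' hI'
            rw [hsum]
            split_ifs <;> omega
          · rw [hsum, if_pos hiI]
            omega
      · intro s hs
        have hparts := mellinIntegral_by_parts hA p (hconv d k β hd s hs) I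
        rw [← Finset.mul_sum, neg_one_mul, ← hparts, ← heq]
        push_cast
        simp only [Pi.add_apply, Finset.sum_add_distrib]
        ring

end Continuation

/-! ### The Shintani series as a Mellin integral -/

section Series

open MeasureTheory

variable {n r : ℕ} {A : Matrix (Fin n) (Fin r) ℝ}

lemma hasSum_fin_prod_of_nonneg {ι : Type*} {r : ℕ} {f : Fin r → ι → ℝ} {a : Fin r → ℝ}
    (h0 : ∀ j m, 0 ≤ f j m) (h : ∀ j, HasSum (f j) (a j)) :
    HasSum (fun m : Fin r → ι => ∏ j, f j (m j)) (∏ j, a j) := by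
  induction r with
  | zero => simp
  | succ r ih =>
    have ih' := ih (f := fun j => f j.succ) (fun j => h0 j.succ) (fun j => h j.succ)
    have hs := (h 0).summable.mul_of_nonneg ih'.summable (fun m => h0 0 m)
      fun m => Finset.prod_nonneg fun j _ => h0 j.succ _
    have hmul := (h 0).mul ih' hs
    rw [← (Fin.consEquiv fun _ : Fin (r + 1) => ι).hasSum_iff, Fin.prod_univ_succ]
    have he : (fun m : Fin (r + 1) → ι => ∏ j, f j (m j)) ∘ (Fin.consEquiv fun _ => ι) =
        fun x : ι × (Fin r → ι) => f 0 x.1 * ∏ j, f j.succ (x.2 j) := by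
      funext m
      simp [Fin.consEquiv, Fin.prod_univ_succ]
    rw [he]
    exact hmul

lemma integral_exp_mul_exp_neg_mul_exp {a : ℂ} (ha : 0 < a.re) {L : ℝ} (hL : 0 < L) :
    ∫ x : ℝ, Complex.exp (a * x) * Complex.exp (-(L * Real.exp x)) =
      Complex.Gamma a * (L : ℂ) ^ (-a) := by
  have h1 := Complex.integral_cpow_mul_exp_neg_mul_Ioi ha hL
  have himage : Real.exp '' Set.univ = Set.Ioi 0 := by
    rw [Set.image_univ, Real.range_exp]
  rw [← himage, integral_image_eq_integral_abs_deriv_smul MeasurableSet.univ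
    (fun x _ => (Real.hasDerivAt_exp x).hasDerivWithinAt) Real.exp_injective.injOn,
    setIntegral_univ] at h1
  have h2 : ((1 : ℂ) / L) ^ a = (L : ℂ) ^ (-a) := by
    rw [one_div, Complex.cpow_neg, Complex.inv_cpow]
    rw [Complex.arg_ofReal_of_nonneg hL.le]
    exact Real.pi_pos.ne
  rw [mul_comm, ← h2, ← h1]
  refine integral_congr_ae (.of_forall fun x => ?_)
  simp only [Complex.real_smul, abs_of_pos (Real.exp_pos x)]
  rw [← mul_assoc]
  congr 1
  have h0 : ((Real.exp x : ℝ) : ℂ) ≠ 0 := Complex.ofReal_ne_zero.2 (Real.exp_pos x).ne'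
  rw [Complex.cpow_sub _ _ h0, Complex.cpow_one, mul_div_cancel₀ _ h0,
    Complex.cpow_def_of_ne_zero h0, ← Complex.ofReal_log (Real.exp_pos x).le, Real.log_exp,
    mul_comm]

lemma hasSum_exp_neg_mul {y : ℝ} (hy : 0 < y) :
    HasSum (fun m : ℕ+ => Real.exp (-((m : ℕ) * y))) (Real.exp y - 1)⁻¹ := by
  have hlt : Real.exp (-y) < 1 := by
    rw [← Real.exp_zero]
    exact Real.exp_lt_exp.2 (by linarith)
  have h := (hasSum_geometric_of_lt_one (Real.exp_pos _).le hlt).mul_left (Real.exp (-y))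
  have he : (fun m : ℕ+ => Real.exp (-((m : ℕ) * y))) ∘ Equiv.pnatEquivNat.symm =
      fun m : ℕ => Real.exp (-y) * Real.exp (-y) ^ m := by
    funext m
    simp only [Function.comp_apply, Equiv.pnatEquivNat_symm_apply, Nat.succPNat_coe]
    rw [← Real.exp_nat_mul, ← Real.exp_add]
    push_cast
    ring_nf
  have hval : Real.exp (-y) * (1 - Real.exp (-y))⁻¹ = (Real.exp y - 1)⁻¹ := by
    have h0 := Real.exp_pos y
    have h1 : Real.exp y - 1 ≠ 0 := by
      have := Real.add_one_lt_exp hy.ne'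
      linarith
    rw [Real.exp_neg]
    field_simp
  rw [← Equiv.pnatEquivNat.symm.hasSum_iff, he, ← hval]
  exact h

lemma hasSum_kernelProduct (hA : A ∈ ShintaniMatrices n r) (x : Fin n → ℝ) :
    HasSum (fun m : Fin r → ℕ+ => (∏ j, Real.exp (-((m j : ℕ) * columnForm A j x)) : ℝ))
      ‖kernelProduct A 1 0 x‖ ∧ kernelProduct A 1 0 x = (‖kernelProduct A 1 0 x‖ : ℂ) := by
  have heq : kernelProduct A 1 0 x = ((∏ j, (Real.exp (columnForm A j x) - 1)⁻¹ : ℝ) : ℂ) := by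
    rw [kernelProduct, Complex.ofReal_prod]
    refine Finset.prod_congr rfl fun j _ => ?_
    have h0 : (columnForm A j x : ℂ) ≠ 0 :=
      Complex.ofReal_ne_zero.2 (columnForm_pos hA j x).ne'
    simp only [Pi.one_apply, Pi.zero_apply, iteratedDeriv_zero]
    rw [bernoulliKernel_of_ne_zero h0, zpow_neg_one]
    push_cast
    field_simp
  have hpos : 0 ≤ ∏ j, (Real.exp (columnForm A j x) - 1)⁻¹ := Finset.prod_nonneg fun j _ => by
    have := Real.add_one_le_exp (columnForm A j x)
    have := columnForm_pos hA j x
    exact inv_nonneg.2 (by linarith)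
  have hnorm : ‖kernelProduct A 1 0 x‖ = ∏ j, (Real.exp (columnForm A j x) - 1)⁻¹ := by
    rw [heq, Complex.norm_real, Real.norm_of_nonneg hpos]
  refine ⟨?_, by rw [hnorm, heq]⟩
  rw [hnorm]
  exact hasSum_fin_prod_of_nonneg
    (f := fun j (m : ℕ+) => Real.exp (-((m : ℕ) * columnForm A j x))) (fun j m => (Real.exp_pos _).le)
    fun j => hasSum_exp_neg_mul (columnForm_pos hA j x)

lemma shintaniForm_pos (hA : A ∈ ShintaniMatrices n r) (m : Fin r → ℕ+) (i : Fin n) :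
    0 < ∑ j, A i j * ((m j : ℕ) : ℝ) := by
  obtain ⟨j, hj⟩ := hA.2.1 i
  exact Finset.sum_pos' (fun j _ => mul_nonneg (hA.1 i j) (Nat.cast_nonneg _))
    ⟨j, Finset.mem_univ j, mul_pos hj (Nat.cast_pos.2 (m j).pos)⟩

lemma integral_exp_mul_prod_exp_neg (hA : A ∈ ShintaniMatrices n r) {s : Fin n → ℂ}
    (hs : ∀ i, 0 < (s i).re) (m : Fin r → ℕ+) :
    ∫ x : Fin n → ℝ, Complex.exp (∑ i, s i * x i) *
      ((∏ j, Real.exp (-((m j : ℕ) * columnForm A j x)) : ℝ) : ℂ) =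
      (∏ i, Complex.Gamma (s i)) * shintaniTerm A s m := by
  rw [shintaniTerm, ← Finset.prod_mul_distrib]
  rw [Finset.prod_congr rfl fun i _ =>
    (integral_exp_mul_exp_neg_mul_exp (hs i) (shintaniForm_pos hA m i)).symm,
    ← integral_fintype_prod_volume_eq_prod]
  refine integral_congr_ae (.of_forall fun x => ?_)
  simp only
  rw [Finset.prod_mul_distrib, ← Complex.exp_sum, ← Complex.exp_sum, ← Real.exp_sum,
    Complex.ofReal_exp]
  congr 2
  push_cast [columnForm]
  simp only [Finset.mul_sum, Finset.sum_mul, ← Finset.sum_neg_distrib]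
  rw [Finset.sum_comm]
  refine Finset.sum_congr rfl fun i _ => Finset.sum_congr rfl fun j _ => ?_
  ring

lemma supportWeight_one_nonneg (I : Finset (Fin n)) : 0 ≤ supportWeight A 1 I :=
  Finset.sum_nonneg fun _ _ => zero_le_one

/-- On the region of convergence of the Mellin integral the Shintani series converges, and
`∏ Γ(s_i) * ζ_A(s)` is the Mellin integral of `∏_j 1 / (exp ℓ_j - 1)`. -/
theorem summable_and_gamma_mul_shintaniZeta (hA : A ∈ ShintaniMatrices n r) {s : Fin n → ℂ}
    (hs : s ∈ connectedRegion A (supportWeight A 1)) :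
    Summable (shintaniTerm A s) ∧
      (∏ i, Complex.Gamma (s i)) * shintaniZeta A s = mellinIntegral A 1 0 s := by
  have h := supportWeight_lt_sum_of_isConnectedSet hA hs
  have hre : ∀ i, 0 < (s i).re := fun i => by
    have h1 := h {i} (Finset.singleton_nonempty i)
    rw [Finset.sum_singleton] at h1
    exact lt_of_le_of_lt (by exact_mod_cast supportWeight_one_nonneg {i}) h1
  have hint := integrable_exp_mul_kernelProduct hA (k := 1) 0 h
  set F : (Fin r → ℕ+) → (Fin n → ℝ) → ℂ := fun m x => Complex.exp (∑ i, s i * x i) *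
    ((∏ j, Real.exp (-((m j : ℕ) * columnForm A j x)) : ℝ) : ℂ) with hF
  have hnormF : ∀ m x, ‖F m x‖ = ‖Complex.exp (∑ i, s i * x i)‖ *
      ∏ j, Real.exp (-((m j : ℕ) * columnForm A j x)) := fun m x => by
    rw [hF]
    simp only
    rw [norm_mul, Complex.norm_real, Real.norm_of_nonneg
      (Finset.prod_nonneg fun j _ => (Real.exp_pos _).le)]
  have hsumnorm : ∀ x, HasSum (fun m => ‖F m x‖)
      ‖Complex.exp (∑ i, s i * x i) * kernelProduct A 1 0 x‖ := fun x => by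
    simp only [hnormF, norm_mul]
    exact (hasSum_kernelProduct hA x).1.mul_left _
  have hFint : ∀ m, Integrable (F m) := fun m => by
    refine hint.norm.mono' (Continuous.aestronglyMeasurable ?_) (.of_forall fun x => ?_)
    · have := fun j => continuous_columnForm (A := A) j
      rw [hF]
      fun_prop
    · exact le_hasSum (hsumnorm x) m fun _ _ => norm_nonneg _
  have hsum : Summable fun m => ∫ x, ‖F m x‖ := by
    refine summable_of_sum_le (c := ∫ x : Fin n → ℝ,
      ‖Complex.exp (∑ i, s i * x i) * kernelProduct A 1 0 x‖)
      (fun m => integral_nonneg fun x => norm_nonneg _) fun S => ?_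
    rw [← integral_finsetSum _ fun m _ => (hFint m).norm]
    refine integral_mono (integrable_finsetSum _ fun m _ => (hFint m).norm) hint.norm fun x => ?_
    exact sum_le_hasSum S (fun _ _ => norm_nonneg _) (hsumnorm x)
  have hmain := hasSum_integral_of_summable_integral_norm hFint hsum
  have htsum : ∀ x, ∑' m, F m x = Complex.exp (∑ i, s i * x i) * kernelProduct A 1 0 x :=
    fun x => by
      rw [(hasSum_kernelProduct hA x).2]
      exact ((Complex.hasSum_ofReal.2 (hasSum_kernelProduct hA x).1).mul_left _).tsum_eq
  simp only [htsum] at hmain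
  rw [hF] at hmain
  simp only [integral_exp_mul_prod_exp_neg hA hre] at hmain
  have hG : (∏ i, Complex.Gamma (s i)) ≠ 0 :=
    Finset.prod_ne_zero_iff.2 fun i _ => Complex.Gamma_ne_zero_of_re_pos (hre i)
  have hsm : Summable (shintaniTerm A s) := (summable_mul_left_iff hG).1 hmain.summable
  refine ⟨hsm, ?_⟩
  rw [shintaniZeta, ← hsm.tsum_mul_left]
  exact hmain.tsum_eq

end Series

/-! ### Removing the zeros of `1 / Γ` -/

/-- An entire function vanishing at finitely many points is divisible by the corresponding linear
factors. -/
lemma exists_differentiable_mul_prod_sub {g : ℂ → ℂ} (hg : Differentiable ℂ g) (S : Finset ℤ)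
    (h0 : ∀ c ∈ S, g c = 0) :
    ∃ V : ℂ → ℂ, Differentiable ℂ V ∧ ∀ z, V z * ∏ c ∈ S, (z - (c : ℂ)) = g z := by
  induction S using Finset.induction_on generalizing g with
  | empty => exact ⟨g, hg, by simp⟩
  | insert c S hc ih =>
    have hd : Differentiable ℂ (dslope g c) := differentiableOn_univ.1
      ((Complex.differentiableOn_dslope Filter.univ_mem).2 hg.differentiableOn)
    have hmul : ∀ z : ℂ, (z - c) * dslope g c z = g z := fun z => by
      have := sub_smul_dslope g (c : ℂ) z
      rwa [h0 c (Finset.mem_insert_self _ _), sub_zero, smul_eq_mul] at this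
    obtain ⟨V, hV, hVz⟩ := ih hd fun c' hc' => by
      have h1 := hmul c'
      rw [h0 c' (Finset.mem_insert_of_mem hc')] at h1
      refine (mul_eq_zero.1 h1).resolve_left (sub_ne_zero.2 fun h => hc ?_)
      rwa [← Int.cast_injective h]
    refine ⟨V, hV, fun z => ?_⟩
    rw [Finset.prod_insert hc, ← hmul z, ← hVz z]
    ring

lemma exists_differentiable_mul_prod_sub_mul_Gamma (S : Finset ℤ) (hS : ∀ c ∈ S, c ≤ 0) :
    ∃ V : ℂ → ℂ, Differentiable ℂ V ∧
      ∀ z, 0 < z.re → V z * (∏ c ∈ S, (z - (c : ℂ))) * Complex.Gamma z = 1 := by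
  obtain ⟨V, hV, hVz⟩ := exists_differentiable_mul_prod_sub
    Complex.differentiable_one_div_Gamma S fun c hc => by
      obtain ⟨m, rfl⟩ := Int.exists_eq_neg_ofNat (hS c hc)
      simp [Complex.Gamma_neg_nat_eq_zero]
  exact ⟨V, hV, fun z hz => by
    rw [hVz, inv_mul_cancel₀ (Complex.Gamma_ne_zero_of_re_pos hz)]⟩

section Final

variable {n r : ℕ} {A : Matrix (Fin n) (Fin r) ℝ}

/-! ### The regions attached to connected sets -/

lemma isOpen_connectedRegion (d : Finset (Fin n) → ℤ) : IsOpen (connectedRegion A d) := by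
  have : connectedRegion A d =
      ⋂ I, {s : Fin n → ℂ | IsConnectedSet A I → (d I : ℝ) < ∑ i ∈ I, (s i).re} := by
    ext s
    simp [connectedRegion]
  rw [this]
  refine isOpen_iInter_of_finite fun I => ?_
  by_cases hI : IsConnectedSet A I
  · simp only [hI, true_imp_iff]
    exact isOpen_lt continuous_const (by fun_prop)
  · simp [hI]

lemma convex_connectedRegion (d : Finset (Fin n) → ℤ) : Convex ℝ (connectedRegion A d) := by
  intro s hs t ht a b ha hb hab I hI
  have h1 := hs I hI
  have h2 := ht I hI
  have h3 : ∑ i ∈ I, ((a • s + b • t) i).re =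
      a * ∑ i ∈ I, (s i).re + b * ∑ i ∈ I, (t i).re := by
    simp [Finset.sum_add_distrib, Finset.mul_sum]
  rw [h3]
  rcases ha.eq_or_lt with rfl | ha'
  · rw [zero_add] at hab
    subst hab
    simpa using h2
  · have h4 : (d I : ℝ) = a * d I + b * d I := by rw [← add_mul, hab, one_mul]
    nlinarith [mul_lt_mul_of_pos_left h1 ha', mul_le_mul_of_nonneg_left h2.le hb]

lemma supportWeight_one_le (I : Finset (Fin n)) : supportWeight A 1 I ≤ r := by
  have h : ((Finset.univ.filter fun j => columnSupport A j ⊆ I).card : ℤ) ≤ r := by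
    exact_mod_cast (Finset.card_le_univ _).trans_eq (Fintype.card_fin r)
  simpa [supportWeight] using h

lemma mem_connectedRegion_of_lt_re {s : Fin n → ℂ} (hs : ∀ i, (r : ℝ) < (s i).re) :
    s ∈ connectedRegion A (supportWeight A 1) := by
  intro I hI
  obtain ⟨i, hi⟩ := hI.1
  have h1 : (supportWeight A 1 I : ℝ) ≤ r := by exact_mod_cast supportWeight_one_le I
  have h2 : (s i).re ≤ ∑ i ∈ I, (s i).re :=
    Finset.single_le_sum (f := fun i => (s i).re)
      (fun i _ => (Nat.cast_nonneg r).trans (hs i).le) hi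
  linarith [hs i]

lemma exists_mem_connectedRegion_sub (s : Fin n → ℂ) :
    ∃ M : ℕ, s ∈ connectedRegion A fun I => supportWeight A 1 I - M := by
  obtain ⟨M, hM⟩ := exists_nat_gt ((r : ℝ) + ∑ i, |(s i).re|)
  refine ⟨M, fun I _ => ?_⟩
  have h1 : (supportWeight A 1 I : ℝ) ≤ r := by exact_mod_cast supportWeight_one_le I
  have h2 : -∑ i ∈ I, (s i).re ≤ ∑ i, |(s i).re| := by
    rw [← Finset.sum_neg_distrib]
    exact (Finset.sum_le_sum fun i _ => neg_le_abs _).trans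
      (Finset.sum_le_sum_of_subset_of_nonneg (Finset.subset_univ I) fun i _ _ => abs_nonneg _)
  push_cast
  linarith

lemma isConnectedSet_singleton (i : Fin n) : IsConnectedSet A {i} :=
  ⟨Finset.singleton_nonempty i, fun _ h₁ hne _ => (hne.subset_singleton_iff.1 h₁)⟩

/-! ### The polar hyperplanes -/

open Classical in
/-- The hyperplanes `∑_{i ∈ I} s_i = c` with `I` connected and `w - M < c ≤ w`, where `w` is the
weight of `I`, leaving out `s_i = c` for `c ≤ 0`. -/
noncomputable def polarForms (A : Matrix (Fin n) (Fin r) ℝ) (M : ℕ) :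
    Finset ((Fin n → ℤ) × ℤ) :=
  ((Finset.univ.filter (IsConnectedSet A)).sigma fun I =>
    (Finset.Ioc (supportWeight A 1 I - M) (supportWeight A 1 I)).filter
      fun c => I.card = 1 → 1 ≤ c).image fun x => (indicatorVector x.1, x.2)

lemma indicatorVector_injective :
    Function.Injective (indicatorVector : Finset (Fin n) → Fin n → ℤ) := by
  intro I I' h
  ext i
  have := congrFun h i
  by_cases h1 : i ∈ I <;> by_cases h2 : i ∈ I' <;> simp_all [indicatorVector]

lemma hyperplaneForm_indicatorVector (I : Finset (Fin n)) (c : ℤ) (s : Fin n → ℂ) :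
    hyperplaneForm (indicatorVector I, c) s = ∑ i ∈ I, s i - (c : ℂ) := by
  rw [hyperplaneForm, sum_indicatorVector_mul]

lemma mem_polarForms {M : ℕ} {q : (Fin n → ℤ) × ℤ} : q ∈ polarForms A M ↔
    ∃ I c, IsConnectedSet A I ∧ c ∈ Finset.Ioc (supportWeight A 1 I - M) (supportWeight A 1 I) ∧
      (I.card = 1 → 1 ≤ c) ∧ q = (indicatorVector I, c) := by
  classical
  simp only [polarForms, Finset.mem_image, Finset.mem_sigma, Finset.mem_filter, Finset.mem_univ,
    true_and]
  constructor
  · rintro ⟨⟨I, c⟩, ⟨hI, hc, h1⟩, rfl⟩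
    exact ⟨I, c, hI, hc, h1, rfl⟩
  · rintro ⟨I, c, hI, hc, h1, rfl⟩
    exact ⟨⟨I, c⟩, ⟨hI, hc, h1⟩, rfl⟩

lemma mem_shintaniPolarHyperplanes_of_mem_polarForms (hA : A ∈ ShintaniMatrices n r) {M : ℕ}
    {q : (Fin n → ℤ) × ℤ} (hq : q ∈ polarForms A M) : q ∈ shintaniPolarHyperplanes A := by
  obtain ⟨I, c, hI, hc, h1, rfl⟩ := mem_polarForms.1 hq
  have hc' := (Finset.mem_Ioc.1 hc).2
  refine ⟨Finset.univ, indicatorVector I, supportWeight A 1 I, (supportWeight A 1 I - c).toNat,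
    isPrimitiveFacetNormal_indicatorVector hA hI, fun i hi => ?_, ?_⟩
  · have hs : indicatorVector I = indicatorVector {i} := by
      rw [hi]
      funext i'
      simp [indicatorVector, Pi.single_apply]
    have hIi := indicatorVector_injective hs
    have := h1 (by rw [hIi, Finset.card_singleton])
    omega
  · rw [Int.toNat_of_nonneg (by omega)]
    simp

lemma analyticAt_hyperplaneForm (q : (Fin n → ℤ) × ℤ) (s : Fin n → ℂ) :
    AnalyticAt ℂ (hyperplaneForm q) s := by
  refine AnalyticAt.sub (Finset.analyticAt_fun_sum _ fun i _ => analyticAt_const.mul ?_)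
    analyticAt_const
  exact (ContinuousLinearMap.proj (R := ℂ) (φ := fun _ : Fin n => ℂ) i).analyticAt s

lemma prod_polarForms (M : ℕ) (s : Fin n → ℂ) : (∏ q ∈ polarForms A M, hyperplaneForm q s) *
    ∏ i : Fin n, ∏ c ∈ (Finset.Ioc (supportWeight A 1 {i} - M) (supportWeight A 1 {i})).filter
      (fun c => c ≤ 0), (s i - (c : ℂ)) =
    polarProduct A (fun I => supportWeight A 1 I - M) (supportWeight A 1) s := by
  classical
  have h1 : ∏ q ∈ polarForms A M, hyperplaneForm q s = ∏ I with IsConnectedSet A I,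
      ∏ c ∈ (Finset.Ioc (supportWeight A 1 I - M) (supportWeight A 1 I)).filter
        (fun c => I.card = 1 → 1 ≤ c), (∑ i ∈ I, s i - (c : ℂ)) := by
    rw [polarForms, Finset.prod_image, Finset.prod_sigma]
    · simp only [hyperplaneForm_indicatorVector]
    · rintro ⟨I, c⟩ - ⟨I', c'⟩ - h
      obtain ⟨h1, h2⟩ := Prod.mk.inj h
      obtain rfl := indicatorVector_injective h1
      obtain rfl : c = c' := h2
      rfl
  have h2 : ∏ i : Fin n, ∏ c ∈ (Finset.Ioc (supportWeight A 1 {i} - M)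
      (supportWeight A 1 {i})).filter (fun c => c ≤ 0), (s i - (c : ℂ)) =
      ∏ I with IsConnectedSet A I,
      ∏ c ∈ (Finset.Ioc (supportWeight A 1 I - M) (supportWeight A 1 I)).filter
        (fun c => ¬ (I.card = 1 → 1 ≤ c)), (∑ i ∈ I, s i - (c : ℂ)) := by
    have hsub : Finset.univ.map
        (⟨singleton, Finset.singleton_injective⟩ : Fin n ↪ Finset (Fin n)) ⊆
        Finset.univ.filter (IsConnectedSet A) := fun I hI => by
      obtain ⟨i, -, rfl⟩ := Finset.mem_map.1 hI
      simpa using isConnectedSet_singleton i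
    rw [← Finset.prod_subset hsub, Finset.prod_map]
    · refine Finset.prod_congr rfl fun i _ => ?_
      simp only [Function.Embedding.coeFn_mk, Finset.card_singleton, Finset.sum_singleton]
      exact Finset.prod_congr (Finset.filter_congr fun c _ => by
        simp only [forall_const, not_le]
        omega) fun _ _ => rfl
    · intro I _ hI
      have hcard : I.card ≠ 1 := fun h => by
        obtain ⟨i, rfl⟩ := Finset.card_eq_one.1 h
        exact hI (Finset.mem_map.2 ⟨i, Finset.mem_univ i, rfl⟩)
      simp [hcard]
  rw [h1, h2, ← Finset.prod_mul_distrib, polarProduct]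
  refine Finset.prod_congr (by congr) fun I _ => ?_
  rw [Finset.prod_filter_mul_prod_filter_not]

/-! ### The continuation of the Shintani zeta function -/

/-- For every `M`, after multiplication with finitely many affine forms the zeta function extends
analytically to a region that grows with `M`. The integral `∏ Γ(s_i) * ζ_A(s)` has this property
with the forms `s_i - c`, `c ≤ 0`, in addition; these divide the entire functions `1 / Γ(s_i)`. -/
theorem exists_analyticOnNhd_eq_prod_polarForms_mul (hA : A ∈ ShintaniMatrices n r) (M : ℕ) :
    ∃ E : (Fin n → ℂ) → ℂ,
      AnalyticOnNhd ℂ E (connectedRegion A fun I => supportWeight A 1 I - M) ∧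
      ∀ s ∈ connectedRegion A (supportWeight A 1),
        E s = (∏ q ∈ polarForms A M, hyperplaneForm q s) * shintaniZeta A s := by
  obtain ⟨E, hE, he⟩ := hasContinuation_mellinIntegral hA (fun I => supportWeight A 1 I - M)
    (supportWeight A 1) 1 0 0 (by simp)
  choose V hV hVz using fun i : Fin n => exists_differentiable_mul_prod_sub_mul_Gamma
    ((Finset.Ioc (supportWeight A 1 {i} - M) (supportWeight A 1 {i})).filter
      fun c => c ≤ 0) fun c hc => (Finset.mem_filter.1 hc).2
  refine ⟨fun s => E s * ∏ i, V i (s i), fun s hs => (hE s hs).mul ?_, fun s hs => ?_⟩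
  · refine Finset.analyticAt_fun_prod _ fun i _ => ?_
    have h1 : AnalyticAt ℂ (V i) (s i) := (hV i).analyticAt _
    exact h1.comp (f := fun s : Fin n → ℂ => s i)
      ((ContinuousLinearMap.proj (R := ℂ) (φ := fun _ : Fin n => ℂ) i).analyticAt s)
  · have hre : ∀ i, 0 < (s i).re := fun i => by
      have h1 := hs {i} (isConnectedSet_singleton i)
      rw [Finset.sum_singleton] at h1
      exact lt_of_le_of_lt (by exact_mod_cast supportWeight_one_nonneg {i}) h1
    have h0 : (s + fun i => (((0 : Fin n → ℕ) i : ℕ) : ℂ)) = s := by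
      funext i
      simp
    have h1 : (∏ i, V i (s i)) * (∏ i : Fin n,
        ∏ c ∈ (Finset.Ioc (supportWeight A 1 {i} - M) (supportWeight A 1 {i})).filter
          (fun c => c ≤ 0), (s i - (c : ℂ))) * ∏ i, Complex.Gamma (s i) = 1 := by
      rw [← Finset.prod_mul_distrib, ← Finset.prod_mul_distrib]
      exact Finset.prod_eq_one fun i _ => hVz i (s i) (hre i)
    simp only [he s hs, h0]
    rw [← prod_polarForms, ← (summable_and_gamma_mul_shintaniZeta hA hs).2]
    linear_combination ((∏ q ∈ polarForms A M, hyperplaneForm q s) * shintaniZeta A s) * h1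

/-- The point `s + (t, …, t)`. -/
def diagonalShift (s : Fin n → ℂ) (t : ℂ) (i : Fin n) : ℂ := s i + t

lemma analyticAt_diagonalShift (s : Fin n → ℂ) (t : ℂ) : AnalyticAt ℂ (diagonalShift s) t := by
  rw [show diagonalShift s = fun t i => s i + t from rfl, analyticAt_pi_iff]
  intro i
  fun_prop

lemma diagonalShift_mem_connectedRegion {d : Finset (Fin n) → ℤ} {s : Fin n → ℂ}
    (hs : s ∈ connectedRegion A d) {t : ℂ} (ht : 0 ≤ t.re) :
    diagonalShift s t ∈ connectedRegion A d := fun I hI =>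
  (hs I hI).trans_le (Finset.sum_le_sum fun i _ => by simpa [diagonalShift] using ht)

lemma shintaniTerm_diagonalShift (hA : A ∈ ShintaniMatrices n r) (s : Fin n → ℂ) (t : ℂ)
    (m : Fin r → ℕ+) : shintaniTerm A (diagonalShift s t) m =
      shintaniTerm A s m * ∏ i, ((∑ j, A i j * ((m j : ℕ) : ℝ) : ℝ) : ℂ) ^ (-t) := by
  rw [shintaniTerm, shintaniTerm, ← Finset.prod_mul_distrib]
  refine Finset.prod_congr rfl fun i _ => ?_
  rw [← Complex.cpow_add _ _ (Complex.ofReal_ne_zero.2 (shintaniForm_pos hA m i).ne'),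
    diagonalShift]
  ring_nf

/-- The terms of the series are bounded, uniformly on the strip `0 ≤ Re t ≤ R`, by a multiple of
their values at `t = 0`, since the linear forms are bounded below. -/
lemma exists_norm_shintaniTerm_diagonalShift_le (hA : A ∈ ShintaniMatrices n r) (s : Fin n → ℂ)
    (R : ℝ) : ∃ K : ℝ, ∀ (m : Fin r → ℕ+) (t : ℂ), 0 ≤ t.re → t.re ≤ R →
      ‖shintaniTerm A (diagonalShift s t) m‖ ≤ ‖shintaniTerm A s m‖ * K := by
  obtain ⟨c, hc, hcA⟩ := exists_pos_forall_le (P := fun _ : Fin n => True)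
    (fun i => ∑ j, A i j) (fun i _ => by
      obtain ⟨j, hj⟩ := hA.2.1 i
      exact Finset.sum_pos' (fun j _ => hA.1 i j) ⟨j, Finset.mem_univ j, hj⟩)
  set b := min c 1 with hb
  have hb0 : 0 < b := lt_min hc one_pos
  refine ⟨∏ _i : Fin n, b ^ (-R), fun m t ht htR => ?_⟩
  rw [shintaniTerm_diagonalShift hA, norm_mul, norm_prod]
  refine mul_le_mul_of_nonneg_left (Finset.prod_le_prod (fun i _ => norm_nonneg _)
    fun i _ => ?_) (norm_nonneg _)
  have hpos := shintaniForm_pos hA m i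
  have hle : b ≤ ∑ j, A i j * ((m j : ℕ) : ℝ) :=
    (min_le_left _ _).trans ((hcA i trivial).trans (Finset.sum_le_sum fun j _ =>
      le_mul_of_one_le_right (hA.1 i j) (by exact_mod_cast (one_le : 1 ≤ m j))))
  rw [Complex.norm_cpow_eq_rpow_re_of_pos hpos, Complex.neg_re]
  exact (Real.rpow_le_rpow_of_nonpos hb0 hle (by linarith)).trans
    (Real.rpow_le_rpow_of_exponent_ge hb0 (min_le_right _ _) (by linarith))

lemma differentiable_shintaniTerm_diagonalShift (hA : A ∈ ShintaniMatrices n r) (s : Fin n → ℂ)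
    (m : Fin r → ℕ+) : Differentiable ℂ fun t => shintaniTerm A (diagonalShift s t) m := by
  have h : (fun t => shintaniTerm A (diagonalShift s t) m) = fun t =>
      shintaniTerm A s m * ∏ i, ((∑ j, A i j * ((m j : ℕ) : ℝ) : ℝ) : ℂ) ^ (-t) :=
    funext fun t => shintaniTerm_diagonalShift hA s t m
  rw [h]
  refine (Differentiable.fun_finsetProd fun i _ => ?_).const_mul _
  exact differentiable_neg.const_cpow
    (Or.inl (Complex.ofReal_ne_zero.2 (shintaniForm_pos hA m i).ne'))

/-- The continuation agrees with the sum of the series wherever the latter converges. Along the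
half-line `s + (t, …, t)`, `t > 0`, the series remains convergent and analytic in `t`, and it
reaches the region where the identity is known; let `t` tend to `0`. -/
theorem eq_prod_polarForms_mul_of_summable (hA : A ∈ ShintaniMatrices n r) {M : ℕ}
    {E : (Fin n → ℂ) → ℂ}
    (hE : AnalyticOnNhd ℂ E (connectedRegion A fun I => supportWeight A 1 I - M))
    (he : ∀ s ∈ connectedRegion A (supportWeight A 1),
        E s = (∏ q ∈ polarForms A M, hyperplaneForm q s) * shintaniZeta A s)
    {s : Fin n → ℂ} (hs : s ∈ connectedRegion A fun I => supportWeight A 1 I - M)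
    (hsum : Summable (shintaniTerm A s)) :
    E s = (∏ q ∈ polarForms A M, hyperplaneForm q s) * shintaniZeta A s := by
  set R₀ : ℝ := r + ∑ i, |(s i).re| + 1 with hR₀
  have hR₀0 : 0 < R₀ := by positivity
  have hfar : ∀ t : ℂ, R₀ ≤ t.re →
      diagonalShift s t ∈ connectedRegion A (supportWeight A 1) := fun t ht =>
    mem_connectedRegion_of_lt_re fun i => by
      have h1 : |(s i).re| ≤ ∑ i, |(s i).re| :=
        Finset.single_le_sum (f := fun i => |(s i).re|) (fun i _ => abs_nonneg _)
          (Finset.mem_univ i)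
      have h2 := neg_abs_le (s i).re
      simp only [diagonalShift, Complex.add_re]
      linarith
  set W : Set ℂ := Complex.re ⁻¹' Set.Ioo 0 (R₀ + 2) with hW
  have hWo : IsOpen W := isOpen_Ioo.preimage Complex.continuous_re
  have hWc : Convex ℝ W := (convex_Ioo 0 (R₀ + 2)).linear_preimage Complex.reLm
  set T : Set ℂ := insert 0 W with hT
  have hTre : ∀ t ∈ T, 0 ≤ t.re ∧ t.re ≤ R₀ + 2 := by
    rintro t (rfl | ht)
    · simp
      linarith
    · exact ⟨ht.1.le, ht.2.le⟩
  have hWT : W ⊆ T := Set.subset_insert _ _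
  have h0W : (0 : ℂ) ∈ closure W := by
    refine Metric.mem_closure_iff.2 fun ε hε => ⟨((min ε R₀ / 2 : ℝ) : ℂ), ?_, ?_⟩
    · have h1 : 0 < min ε R₀ := lt_min hε hR₀0
      have h2 := min_le_right ε R₀
      rw [hW, Set.mem_preimage, Complex.ofReal_re]
      constructor <;> linarith
    · have h1 : 0 < min ε R₀ := lt_min hε hR₀0
      have h2 := min_le_left ε R₀
      rw [dist_zero_left, Complex.norm_real, Real.norm_of_nonneg (by linarith)]
      linarith
  obtain ⟨K, hK⟩ := exists_norm_shintaniTerm_diagonalShift_le hA s (R₀ + 2)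
  have hu : Summable fun m => ‖shintaniTerm A s m‖ * K := hsum.norm.mul_right K
  have hζd : DifferentiableOn ℂ (fun t => shintaniZeta A (diagonalShift s t)) W :=
    Complex.differentiableOn_tsum_of_summable_norm hu
      (fun m => (differentiable_shintaniTerm_diagonalShift hA s m).differentiableOn) hWo
      fun m t ht => hK m t (hTre t (hWT ht)).1 (hTre t (hWT ht)).2
  have hζc : ContinuousOn (fun t => shintaniZeta A (diagonalShift s t)) T :=
    continuousOn_tsum
      (fun m => (differentiable_shintaniTerm_diagonalShift hA s m).continuous.continuousOn) hu
      fun m t ht => hK m t (hTre t ht).1 (hTre t ht).2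
  have hEa : ∀ t ∈ T, AnalyticAt ℂ (fun t => E (diagonalShift s t)) t := fun t ht =>
    (hE _ (diagonalShift_mem_connectedRegion hs (hTre t ht).1)).comp
      (analyticAt_diagonalShift s t)
  have hQa : ∀ t, AnalyticAt ℂ
      (fun t => ∏ q ∈ polarForms A M, hyperplaneForm q (diagonalShift s t)) t := fun t =>
    Finset.analyticAt_fun_prod _ fun q _ =>
      (analyticAt_hyperplaneForm q _).comp (analyticAt_diagonalShift s t)
  have hEq : Set.EqOn (fun t => E (diagonalShift s t)) (fun t =>
      (∏ q ∈ polarForms A M, hyperplaneForm q (diagonalShift s t)) *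
        shintaniZeta A (diagonalShift s t)) W := by
    refine AnalyticOnNhd.eqOn_of_preconnected_of_eventuallyEq (𝕜 := ℂ)
      (z₀ := ((R₀ + 1 : ℝ) : ℂ)) (fun t ht => hEa t (hWT ht))
      (fun t ht => (hQa t).mul (hζd.analyticAt (hWo.mem_nhds ht))) hWc.isPreconnected ?_ ?_
    · rw [hW, Set.mem_preimage, Complex.ofReal_re]
      constructor <;> linarith
    · have : {t : ℂ | R₀ < t.re} ∈ 𝓝 ((R₀ + 1 : ℝ) : ℂ) :=
        (isOpen_lt continuous_const Complex.continuous_re).mem_nhds (by simp)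
      filter_upwards [this] with t ht
      exact he _ (hfar t (le_of_lt ht))
  have hEqT := hEq.of_subset_closure (t := T)
    (fun t ht => (hEa t ht).continuousAt.continuousWithinAt)
    (fun t ht => (hQa t).continuousAt.continuousWithinAt.mul (hζc t ht)) hWT
    (Set.insert_subset h0W subset_closure)
  have h00 : diagonalShift s 0 = s := by
    funext i
    simp [diagonalShift]
  simpa [h00] using hEqT (Set.mem_insert 0 W)

lemma eqOn_mul_prod_polarForms {M M' : ℕ}
    {E E' : (Fin n → ℂ) → ℂ}
    (hE : AnalyticOnNhd ℂ E (connectedRegion A fun I => supportWeight A 1 I - M))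
    (he : ∀ s ∈ connectedRegion A (supportWeight A 1),
        E s = (∏ q ∈ polarForms A M, hyperplaneForm q s) * shintaniZeta A s)
    (hE' : AnalyticOnNhd ℂ E' (connectedRegion A fun I => supportWeight A 1 I - M'))
    (he' : ∀ s ∈ connectedRegion A (supportWeight A 1),
        E' s = (∏ q ∈ polarForms A M', hyperplaneForm q s) * shintaniZeta A s) :
    Set.EqOn (fun s => E s * ∏ q ∈ polarForms A M', hyperplaneForm q s)
      (fun s => E' s * ∏ q ∈ polarForms A M, hyperplaneForm q s)
      (connectedRegion A (fun I => supportWeight A 1 I - M) ∩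
        connectedRegion A fun I => supportWeight A 1 I - M') := by
  have hQ : ∀ (M : ℕ) (s : Fin n → ℂ),
      AnalyticAt ℂ (fun s => ∏ q ∈ polarForms A M, hyperplaneForm q s) s := fun M s =>
    Finset.analyticAt_fun_prod _ fun q _ => analyticAt_hyperplaneForm q s
  have hsub : ∀ M : ℕ, connectedRegion A (supportWeight A 1) ⊆
      connectedRegion A fun I => supportWeight A 1 I - M := fun M =>
    connectedRegion_anti fun I _ => by omega
  have hz : (fun _ => ((r + 1 : ℝ) : ℂ)) ∈ connectedRegion A (supportWeight A 1) :=
    mem_connectedRegion_of_lt_re fun i => by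
      rw [Complex.ofReal_re]
      linarith
  refine AnalyticOnNhd.eqOn_of_preconnected_of_eventuallyEq (𝕜 := ℂ)
    (fun s hs => (hE s hs.1).mul (hQ M' s)) (fun s hs => (hE' s hs.2).mul (hQ M s))
    ((convex_connectedRegion _).inter (convex_connectedRegion _)).isPreconnected
    ⟨hsub M hz, hsub M' hz⟩ ?_
  filter_upwards [(isOpen_connectedRegion _).mem_nhds hz] with s hs
  rw [he s hs, he' s hs]
  ring

/-- The global continuation: a function equal to the series where it converges, and such that for
every `M` its product with the forms in `polarForms A M` is analytic on the `M`-th region, off the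
zeros of these forms. -/
theorem exists_shintani_continuation (hA : A ∈ ShintaniMatrices n r) :
    ∃ F : (Fin n → ℂ) → ℂ, (∀ s, Summable (shintaniTerm A s) → F s = shintaniZeta A s) ∧
      ∀ M : ℕ, ∃ E : (Fin n → ℂ) → ℂ,
        AnalyticOnNhd ℂ E (connectedRegion A fun I => supportWeight A 1 I - M) ∧
        ∀ s ∈ connectedRegion A fun I => supportWeight A 1 I - M,
          (∏ q ∈ polarForms A M, hyperplaneForm q s) ≠ 0 →
            (∏ q ∈ polarForms A M, hyperplaneForm q s) * F s = E s := by
  classical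
  choose E hE he using exists_analyticOnNhd_eq_prod_polarForms_mul hA
  set P : (Fin n → ℂ) → ℕ → Prop := fun s M =>
    s ∈ connectedRegion A (fun I => supportWeight A 1 I - M) ∧
      (∏ q ∈ polarForms A M, hyperplaneForm q s) ≠ 0 with hP
  -- at `s` any index `M` may be used whose forms do not vanish at `s`: all give the same quotient
  refine ⟨fun s => if Summable (shintaniTerm A s) then shintaniZeta A s
    else if h : ∃ M, P s M then
      E h.choose s / ∏ q ∈ polarForms A h.choose, hyperplaneForm q s
    else 0, fun s hs => by simp [hs], fun M => ⟨E M, hE M, fun s hs hne => ?_⟩⟩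
  by_cases hsum : Summable (shintaniTerm A s)
  · simp only [hsum, if_true]
    exact (eq_prod_polarForms_mul_of_summable hA (hE M) (he M) hs hsum).symm
  · have h : ∃ M, P s M := ⟨M, hs, hne⟩
    simp only [hsum, if_false, dif_pos h]
    have hspec := h.choose_spec
    have heq := eqOn_mul_prod_polarForms (hE M) (he M) (hE h.choose) (he h.choose)
      ⟨hs, hspec.1⟩
    simp only at heq
    rw [← mul_div_assoc, div_eq_iff hspec.2, heq, mul_comm]

/-- The local description of the continuation: multiplied with the affine forms in `T`, all of
which vanish at `s₀`, it is analytic at `s₀`. -/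
lemma exists_analyticAt_prod_hyperplaneForm_mul {F : (Fin n → ℂ) → ℂ}
    (hF : ∀ M : ℕ, ∃ E : (Fin n → ℂ) → ℂ,
      AnalyticOnNhd ℂ E (connectedRegion A fun I => supportWeight A 1 I - M) ∧
      ∀ s ∈ connectedRegion A fun I => supportWeight A 1 I - M,
        (∏ q ∈ polarForms A M, hyperplaneForm q s) ≠ 0 →
          (∏ q ∈ polarForms A M, hyperplaneForm q s) * F s = E s) (s₀ : Fin n → ℂ) :
    ∃ M, ∃ T ⊆ polarForms A M, (∀ q ∈ T, hyperplaneForm q s₀ = 0) ∧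
      ∃ g : (Fin n → ℂ) → ℂ, AnalyticAt ℂ g s₀ ∧
        ∀ᶠ s in 𝓝 s₀, (∀ q ∈ T, hyperplaneForm q s ≠ 0) →
          (∏ q ∈ T, hyperplaneForm q s) * F s = g s := by
  classical
  obtain ⟨M, hM⟩ := exists_mem_connectedRegion_sub (A := A) s₀
  obtain ⟨E, hE, he⟩ := hF M
  set B : (Fin n → ℂ) → ℂ := fun s =>
    ∏ q ∈ (polarForms A M).filter (fun q => ¬ hyperplaneForm q s₀ = 0), hyperplaneForm q s with hB
  have hBa : AnalyticAt ℂ B s₀ :=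
    Finset.analyticAt_fun_prod _ fun q _ => analyticAt_hyperplaneForm q s₀
  have hB0 : B s₀ ≠ 0 := Finset.prod_ne_zero_iff.2 fun q hq => (Finset.mem_filter.1 hq).2
  refine ⟨M, (polarForms A M).filter (fun q => hyperplaneForm q s₀ = 0),
    Finset.filter_subset _ _, fun q hq => (Finset.mem_filter.1 hq).2,
    fun s => E s / B s, (hE s₀ hM).div hBa hB0, ?_⟩
  filter_upwards [(isOpen_connectedRegion _).mem_nhds hM,
    hBa.continuousAt.eventually_ne hB0] with s hs hBs hT
  have hsplit := Finset.prod_filter_mul_prod_filter_not (polarForms A M)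
    (fun q => hyperplaneForm q s₀ = 0) (fun q => hyperplaneForm q s)
  have h1 := he s hs (by
    rw [← hsplit]
    exact mul_ne_zero (Finset.prod_ne_zero_iff.2 hT) hBs)
  rw [eq_div_iff hBs, ← h1, ← hsplit]
  ring

lemma hyperplaneForm_diagonalShift (I : Finset (Fin n)) (c : ℤ) (s : Fin n → ℂ) (t : ℂ) :
    hyperplaneForm (indicatorVector I, c) (diagonalShift s t) =
      hyperplaneForm (indicatorVector I, c) s + I.card * t := by
  rw [hyperplaneForm_indicatorVector, hyperplaneForm_indicatorVector]
  simp [diagonalShift, Finset.sum_add_distrib]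
  ring

end Final

theorem mainTheorem1 (n r : ℕ) (A : Matrix (Fin n) (Fin r) ℝ) (hA : A ∈ ShintaniMatrices n r) :
    (∀ s : Fin n → ℂ, (∀ i, (r : ℝ) < (s i).re) → Summable (shintaniTerm A s)) ∧
    ∃ F : (Fin n → ℂ) → ℂ,
      IsMeromorphicOnCn F ∧
      (∀ s : Fin n → ℂ, Summable (shintaniTerm A s) → F s = shintaniZeta A s) ∧
      HasAtMostSimplePolesAlong F (shintaniPolarHyperplanes A) := by
  refine ⟨fun s hs => (summable_and_gamma_mul_shintaniZeta hA
    (mem_connectedRegion_of_lt_re hs)).1, ?_⟩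
  obtain ⟨F, hζ, hF⟩ := exists_shintani_continuation hA
  have hloc := exists_analyticAt_prod_hyperplaneForm_mul hF
  refine ⟨F, fun s₀ => ?_, hζ, fun s₀ => ?_⟩
  · obtain ⟨M, T, hTM, hT, g, hg, hgF⟩ := hloc s₀
    refine ⟨g, fun s => ∏ q ∈ T, hyperplaneForm q s, hg,
      Finset.analyticAt_fun_prod _ fun q _ => analyticAt_hyperplaneForm q s₀, fun hzero => ?_, ?_⟩
    · -- on the line `s₀ + (t, …, t)` the forms are non-zero multiples of `t`
      have h00 : diagonalShift s₀ 0 = s₀ := by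
        funext i
        simp [diagonalShift]
      have htend : Filter.Tendsto (diagonalShift s₀) (𝓝[≠] 0) (𝓝 s₀) := by
        have := (analyticAt_diagonalShift s₀ 0).continuousAt.tendsto
        rw [h00] at this
        exact this.mono_left nhdsWithin_le_nhds
      obtain ⟨t, ht, ht0⟩ := ((htend.eventually hzero).and self_mem_nhdsWithin).exists
      obtain ⟨q, hq, hq0⟩ := Finset.prod_eq_zero_iff.1 ht
      obtain ⟨I, c, hI, -, -, rfl⟩ := mem_polarForms.1 (hTM hq)
      rw [hyperplaneForm_diagonalShift, hT _ hq, zero_add] at hq0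
      rcases mul_eq_zero.1 hq0 with h | h
      · exact hI.1.card_pos.ne' (by exact_mod_cast h)
      · exact ht0 h
    · filter_upwards [hgF] with s hs hne
      rw [eq_div_iff hne, ← hs fun q hq => Finset.prod_ne_zero_iff.1 hne q hq, mul_comm]
  · obtain ⟨M, T, hTM, hT, g, hg, hgF⟩ := hloc s₀
    exact ⟨T, fun q hq => ⟨mem_shintaniPolarHyperplanes_of_mem_polarForms hA (hTM hq), hT q hq⟩,
      g, hg, hgF⟩
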